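/- **Proposition A (Gromov seminorm and scl).** Let $X$ be a path-connected topological space with base point, let $G=\pi_1X$, and let $C_1^{\mathrm{conj}}(G;\mathbb{Z})$ be the quotient of the free abelian group $C_1(G;\mathbb{Z})=\bigoplus_{g\in G}\mathbb{Z}g$ by the subgroup spanned by the elements $w-t^{-1}wt$ with $w,t\in G$. Let $[c]\in C_1^{\mathrm{conj}}(G;\mathbb{Z})$ be represented by a map $\gamma=\coprod_{i\in I}\gamma_i:\coprod_{i\in I}S^1\to X$ with $I$ finite; that is, $[c]=\left[\sum_{i\in I}\lambda_iw_i\right]$ with $\lambda_i\in\mathbb{Z}\smallsetminus\{0\}$ and $w_i\in G$ pairwise non-conjugate, and for each $i$ the free homotopy class of $\gamma_i$ corresponds to the conjugacy class of $w_i^{\lambda_i}$. Then, in $[0,\infty]$ and with $\inf\emptyset=\infty$, $$\operatorname{scl}_{G}([c])=\frac14\inf\left\{\|\alpha\|_1\;\middle|\;\alpha\in H_2(X,\gamma;\mathbb{Q}),\ \partial\alpha=\left[\textstyle\coprod S^1\right]\right\}.$$ Here: - For $g\in G$, $\operatorname{cl}(g)\in\{0,1,\dots,\infty\}$ is the least number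 of commutators with product $g$ ($\infty$ if there is no such product); $\operatorname{cl}(g_1+\dots+g_m)=\inf_{t_1,\dots,t_m\in G}\operatorname{cl}\left(t_1g_1t_1^{-1}\cdots t_mg_mt_m^{-1}\right)$; and $\operatorname{scl}(g_1+\dots+g_m)=\liminf_{n\to\infty}\frac1n\operatorname{cl}(g_1^n+\dots+g_m^n)$, which is the limit along those $n$ for which $\operatorname{cl}$ is finite, and $\infty$ if there are no such $n\geq1$. For a class $[c]$, $\operatorname{scl}_G([c])$ is $\operatorname{scl}\left(\sum_g g^{c_g}\right)$, where $c=\sum_gc_gg\in C_1(G;\mathbb{Z})$ is any representative of $[c]$ and the sum is over the $g$ with $c_g\neq0$; it is part of the statement that the displayed equality holds for every choice of $c$. - $X_\gamma=\left(X\amalg\left(\coprod S^1\times[0,1]\right)\right)/\left((u,0)\sim\gamma(u)\right)$ is the mapping cylinder of $\gamma$, containing $\coprod S^1$ as $\coprod S^1\times\{1\}$, and $H_*(X,\gamma;R)=H_*\left(X_\gamma,\coprod S^1;R\right)$ is relative singular homology. - $\partial:H_2(X,\gamma;\mathbb{Q})\to H_1\left(\coprod S^1;\mathbb{Q}\right)$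 is the boundary map in the long exact sequence of the pair $\left(X_\gamma,\coprod S^1\right)$, and $\left[\coprod S^1\right]$ is the fundamental class. - $\|\alpha\|_1$ is the relative Gromov seminorm of the image of $\alpha$ in $H_2(X,\gamma;\mathbb{R})$: the infimum of $\sum_\sigma|a_\sigma|$ over all real singular $2$-chains $a=\sum_\sigma a_\sigma\sigma$ in $X_\gamma$ with boundary in $\coprod S^1$ that represent this image. -/

import Mathlib

open scoped ENNReal

set_option maxSynthPendingDepth 3

noncomputable section

namespace GromovScl

/-! ### Stable commutator length of integral chains on a group -/

section Algebra

variable {G : Type*} [Group G]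

/-- Commutator length: the least number of commutators whose product is `g`, and `∞` if `g` is not
a product of commutators. -/
def commLength (g : G) : ℕ∞ :=
  ⨅ (L : List (G × G)) (_ : (L.map fun p => p.1 * p.2 * p.1⁻¹ * p.2⁻¹).prod = g), (L.length : ℕ∞)

/-- Commutator length of a formal sum `g₁ + ⋯ + gₘ`: the infimum of the commutator lengths of all
products `g₁' ⋯ gₘ'` with `gᵢ'` conjugate to `gᵢ`. -/
def commLengthSum (L : List G) : ℕ∞ :=
  ⨅ (L' : List G) (_ : List.Forall₂ IsConj L L'), commLength L'.prod

/-- Stable commutator length of a formal sum `g₁ + ⋯ + gₘ`: the limit of `cl(g₁ⁿ + ⋯ + gₘⁿ) / n`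
along those `n` for which the numerator is finite, and `∞` if there are no such `n ≥ 1`.  (The
sequence is `∞` at all other `n ≥ 1`, so this is its lower limit.) -/
def sclSum (L : List G) : ℝ≥0∞ :=
  Filter.liminf (fun n : ℕ => ((commLengthSum (L.map (· ^ n)) : ℕ∞) : ℝ≥0∞) / (n : ℝ≥0∞))
    Filter.atTop

/-- Stable commutator length of an integral chain `∑ λ_g g`: that of the formal sum `∑ g ^ λ_g`. -/
def scl (c : G →₀ ℤ) : ℝ≥0∞ :=
  sclSum (c.support.toList.map fun g => g ^ c g)

variable (G) in
/-- The submodule `K(G; ℤ)` of `C₁(G; ℤ)` spanned by the differences `w - t⁻¹wt`. -/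
def conjSubmodule : Submodule ℤ (G →₀ ℤ) :=
  Submodule.span ℤ
    {κ | ∃ w t : G, κ = Finsupp.single w 1 - Finsupp.single (t⁻¹ * w * t) 1}

variable (G) in
/-- Integral conjugacy classes of chains on `G`. -/
abbrev ConjChains : Type _ := (G →₀ ℤ) ⧸ conjSubmodule G

/-- The class `[c]` of an integral chain `c`. -/
def conjClass (c : G →₀ ℤ) : ConjChains G := (conjSubmodule G).mkQ c

end Algebra

/-! ### Singular homology -/

section Singular

/-- Singular `n`-simplices. -/
abbrev SSimplex (n : ℕ) (Y : Type*) [TopologicalSpace Y] : Type _ :=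
  C(stdSimplex ℝ (Fin (n + 1)), Y)

/-- Singular `n`-chains with coefficients in `R`. -/
abbrev SChain (R : Type*) [CommRing R] (n : ℕ) (Y : Type*) [TopologicalSpace Y] : Type _ :=
  SSimplex n Y →₀ R

variable (R : Type*) [CommRing R] {Y Z : Type*} [TopologicalSpace Y] [TopologicalSpace Z]

/-- The `i`-th face of a singular simplex. -/
def face {n : ℕ} (i : Fin (n + 2)) (σ : SSimplex (n + 1) Y) : SSimplex n Y :=
  σ.comp ⟨stdSimplex.map i.succAbove, stdSimplex.continuous_map _⟩

variable (Y) in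
/-- The singular boundary map `Cₙ₊₁(Y; R) → Cₙ(Y; R)`. -/
def bd (n : ℕ) : SChain R (n + 1) Y →ₗ[R] SChain R n Y :=
  Finsupp.linearCombination R fun σ : SSimplex (n + 1) Y =>
    ∑ i : Fin (n + 2), (-1 : R) ^ (i : ℕ) • Finsupp.single (face i σ) (1 : R)

/-- The map on singular chains induced by a continuous map. -/
def push (n : ℕ) (f : C(Y, Z)) : SChain R n Y →ₗ[R] SChain R n Z :=
  Finsupp.lmapDomain R R fun σ : SSimplex n Y => f.comp σ

lemma bd_single {n : ℕ} (σ : SSimplex (n + 1) Y) (r : R) :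
    bd R Y n (Finsupp.single σ r) =
      r • ∑ i : Fin (n + 2), (-1 : R) ^ (i : ℕ) • Finsupp.single (face i σ) (1 : R) := by
  simp [bd]

lemma push_single {n : ℕ} (f : C(Y, Z)) (σ : SSimplex n Y) (r : R) :
    push R n f (Finsupp.single σ r) = Finsupp.single (f.comp σ) r := by
  simp [push]

lemma bd_push {n : ℕ} (f : C(Y, Z)) (a : SChain R (n + 1) Y) :
    bd R Z n (push R (n + 1) f a) = push R n f (bd R Y n a) := by
  induction a using Finsupp.induction_linear with
  | zero => simp
  | add a b ha hb => simp only [map_add, ha, hb]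
  | single σ r =>
    simp only [push_single, bd_single, map_smul, map_sum]
    rfl

lemma push_injective {n : ℕ} {f : C(Y, Z)} (hf : Function.Injective f) :
    Function.Injective (push R n f) :=
  Finsupp.mapDomain_injective fun _ _ h =>
    ContinuousMap.ext fun x => hf (DFunLike.congr_fun h x)

lemma face_face_swap {n : ℕ} (σ : SSimplex (n + 2) Y) (i : Fin (n + 3)) (j : Fin (n + 2)) :
    face (j.predAbove i) (face (i.succAbove j) σ) = face j (face i σ) := by
  ext x
  simp only [face, ContinuousMap.comp_apply, ContinuousMap.coe_mk, stdSimplex.map_comp_apply]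
  congr 2
  funext k
  exact Fin.succAbove_succAbove_succAbove_predAbove i j k

lemma bd_bd {n : ℕ} (a : SChain R (n + 2) Y) : bd R Y n (bd R Y (n + 1) a) = 0 := by
  induction a using Finsupp.induction_linear with
  | zero => simp
  | add a b ha hb => simp only [map_add, ha, hb, add_zero]
  | single σ r =>
    simp only [bd_single, map_smul, map_sum, one_smul, Finset.smul_sum]
    rw [← Finset.sum_product']
    refine Finset.sum_involution (fun p _ => (p.1.succAbove p.2, p.2.predAbove p.1)) ?_ ?_ ?_ ?_
    · rintro ⟨i, j⟩ -
      have h := Fin.neg_one_pow_succAbove_add_predAbove (R := R) i j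
      rw [pow_add, pow_add] at h
      simp only [face_face_swap, smul_smul, ← add_smul]
      rw [h]
      simp
    · rintro ⟨i, j⟩ - - h
      exact Fin.succAbove_ne i j (congrArg Prod.fst h)
    · simp
    · rintro ⟨i, j⟩ -
      exact Prod.ext (Fin.succAbove_succAbove_predAbove i j) (Fin.predAbove_predAbove_succAbove i j)

variable (Y) in
/-- Singular homology `Hₙ₊₁(Y; R)` (in positive degree `n + 1`). -/
abbrev Homology (n : ℕ) : Type _ :=
  LinearMap.ker (bd R Y n) ⧸
    (LinearMap.range (bd R Y (n + 1))).comap (LinearMap.ker (bd R Y n)).subtype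

variable {A : Type*} [TopologicalSpace A]

/-- The chains in `Cₙ₊₁(Y; R)` that are relative cycles for the pair given by `j : A → Y`, i.e.
whose boundary lies in (the image of) `Cₙ(A; R)`. -/
def relCycles (n : ℕ) (j : C(A, Y)) : Submodule R (SChain R (n + 1) Y) :=
  (LinearMap.range (push R n j)).comap (bd R Y n)

/-- The chains in `Cₙ₊₁(Y; R)` that vanish in relative homology: those of the form `∂b + e` with
`b ∈ Cₙ₊₂(Y; R)` and `e ∈ Cₙ₊₁(A; R)`. -/
def relBoundaries (n : ℕ) (j : C(A, Y)) : Submodule R (SChain R (n + 1) Y) :=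
  LinearMap.range (bd R Y (n + 1)) ⊔ LinearMap.range (push R (n + 1) j)

/-- Relative singular homology `Hₙ₊₁(Y, A; R)` (in positive degree `n + 1`) of the pair given by an
injective map `j : A → Y`. -/
abbrev RelHomology (n : ℕ) (j : C(A, Y)) : Type _ :=
  relCycles R n j ⧸ (relBoundaries R n j).comap (relCycles R n j).subtype

/-- The homology class of a relative cycle. -/
def relClass (n : ℕ) (j : C(A, Y)) : relCycles R n j →ₗ[R] RelHomology R n j :=
  Submodule.mkQ _

/-- The boundary of a relative cycle, as a chain in `A`. -/
def bdInSub (n : ℕ) {j : C(A, Y)} (hj : Function.Injective j) :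
    relCycles R n j →ₗ[R] SChain R n A :=
  (LinearEquiv.ofInjective (push R n j) (push_injective R hj)).symm.toLinearMap ∘ₗ
    (bd R Y n).restrict fun _ ha => ha

lemma push_bdInSub (n : ℕ) {j : C(A, Y)} (hj : Function.Injective j) (a : relCycles R n j) :
    push R n j (bdInSub R n hj a) = bd R Y n a := by
  have h := (LinearEquiv.ofInjective (push R n j) (push_injective R hj)).apply_symm_apply
    ((bd R Y n).restrict (fun _ ha => ha) a)
  exact congrArg Subtype.val h

lemma bd_bdInSub (n : ℕ) {j : C(A, Y)} (hj : Function.Injective j) (a : relCycles R (n + 1) j) :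
    bdInSub R (n + 1) hj a ∈ LinearMap.ker (bd R A n) := by
  apply push_injective R hj
  rw [← bd_push, push_bdInSub, bd_bd, map_zero]

/-- The connecting map `∂ : Hₙ₊₂(Y, A; R) → Hₙ₊₁(A; R)` of the long exact sequence of the pair,
`[a] ↦ [∂a]`. -/
def connecting (n : ℕ) {j : C(A, Y)} (hj : Function.Injective j) :
    RelHomology R (n + 1) j →ₗ[R] Homology R A n :=
  Submodule.mapQ _ _ ((bdInSub R (n + 1) hj).codRestrict _ (bd_bdInSub R n hj)) <| by
    intro a ha
    obtain ⟨_, ⟨b, rfl⟩, _, ⟨e, rfl⟩, h⟩ := Submodule.mem_sup.1 ha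
    refine ⟨e, push_injective R hj ?_⟩
    have h' : (bd R Y (n + 1)) (a : SChain R (n + 2) Y) = push R (n + 1) j (bd R A (n + 1) e) := by
      rw [← bd_push, show (a : SChain R (n + 2) Y) = _ from h.symm, map_add, bd_bd, zero_add]
    exact h'.symm.trans (push_bdInSub R (n + 1) hj a).symm

/-- The `ℓ¹`-norm of a singular chain. -/
def l1Norm {n : ℕ} (a : SChain ℝ n Y) : ℝ≥0∞ := a.sum fun _ r => ENNReal.ofReal |r|

/-- The `ℓ¹`-seminorm on relative homology with real coefficients. -/
def l1Seminorm {n : ℕ} {j : C(A, Y)} (α : RelHomology ℝ n j) : ℝ≥0∞ :=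
  ⨅ (a : relCycles ℝ n j) (_ : relClass ℝ n j a = α), l1Norm (a : SChain ℝ (n + 1) Y)

/-- Inclusion of rational chains into real chains. -/
def toRealChain (n : ℕ) : SChain ℚ n Y →ₛₗ[algebraMap ℚ ℝ] SChain ℝ n Y :=
  Finsupp.mapRange.linearMap (algebraMap ℚ ℝ).toSemilinearMap

lemma toRealChain_single {n : ℕ} (σ : SSimplex n Y) (r : ℚ) :
    toRealChain n (Finsupp.single σ r) = Finsupp.single σ (r : ℝ) := by
  simp [toRealChain]

lemma bd_toRealChain {n : ℕ} (a : SChain ℚ (n + 1) Y) :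
    bd ℝ Y n (toRealChain (n + 1) a) = toRealChain n (bd ℚ Y n a) := by
  induction a using Finsupp.induction_linear with
  | zero => simp
  | add a b ha hb => simp only [map_add, ha, hb]
  | single σ r =>
    simp [toRealChain_single, bd_single, map_smulₛₗ]

lemma push_toRealChain {n : ℕ} (f : C(Y, Z)) (a : SChain ℚ n Y) :
    push ℝ n f (toRealChain n a) = toRealChain n (push ℚ n f a) := by
  induction a using Finsupp.induction_linear with
  | zero => simp
  | add a b ha hb => simp only [map_add, ha, hb]
  | single σ r => simp only [toRealChain_single, push_single]

lemma toRealChain_mem {n : ℕ} {j : C(A, Y)} (a : relCycles ℚ n j) :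
    toRealChain (n + 1) (a : SChain ℚ (n + 1) Y) ∈ relCycles ℝ n j := by
  obtain ⟨a, e, he⟩ := a
  exact ⟨toRealChain n e, by rw [push_toRealChain, he, bd_toRealChain]⟩

/-- Inclusion of rational relative cycles into real relative cycles. -/
def toRealCycle (n : ℕ) (j : C(A, Y)) :
    relCycles ℚ n j →ₛₗ[algebraMap ℚ ℝ] relCycles ℝ n j :=
  ((toRealChain (n + 1)).comp (relCycles ℚ n j).subtype).codRestrict _ toRealChain_mem

/-- The change of coefficients `Hₙ₊₁(Y, A; ℚ) → Hₙ₊₁(Y, A; ℝ)`. -/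
def toRealClass (n : ℕ) (j : C(A, Y)) :
    RelHomology ℚ n j →ₛₗ[algebraMap ℚ ℝ] RelHomology ℝ n j :=
  Submodule.mapQ _ _ (toRealCycle n j) <| by
    intro a ha
    obtain ⟨_, ⟨b, rfl⟩, _, ⟨e, rfl⟩, h⟩ := Submodule.mem_sup.1 ha
    refine Submodule.mem_sup.2 ⟨_, ⟨toRealChain (n + 2) b, rfl⟩, _, ⟨toRealChain (n + 1) e, rfl⟩, ?_⟩
    rw [bd_toRealChain, push_toRealChain, ← map_add, h]
    rfl

end Singular

/-! ### Collections of loops and their mapping cylinders -/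

section Loops

/-- The disjoint union of circles indexed by `ι`. -/
abbrev Circles (ι : Type*) : Type _ := (_ : ι) × Circle

/-- The inclusion of the `i`-th circle. -/
def circleIncl {ι : Type*} (i : ι) : C(Circle, Circles ι) where
  toFun z := ⟨i, z⟩
  continuous_toFun := continuous_sigmaMk (σ := fun _ : ι => Circle)

/-- The loop `t ↦ exp(2πit)` based at `1` in the circle. -/
def circlePath : Path (1 : Circle) 1 where
  toFun t := Circle.exp (2 * Real.pi * t)
  continuous_toFun := by fun_prop
  source' := by simp
  target' := by simp

/-- The singular `1`-simplex in `∐ S¹` running once, in the positive direction, around the `i`-th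
circle. -/
def circleSimplex {ι : Type*} (i : ι) : SSimplex 1 (Circles ι) where
  toFun x := circleIncl i (Circle.exp (2 * Real.pi * (x : Fin 2 → ℝ) 1))
  continuous_toFun := (circleIncl i).continuous.comp <| Circle.exp.continuous.comp <|
    continuous_const.mul ((continuous_apply 1).comp continuous_subtype_val)

/-- The fundamental cycle of `∐ S¹`. -/
def circlesCycle (R : Type*) [CommRing R] (ι : Type*) [Fintype ι] : SChain R 1 (Circles ι) :=
  ∑ i : ι, Finsupp.single (circleSimplex i) 1

lemma circlesCycle_mem (R : Type*) [CommRing R] (ι : Type*) [Fintype ι] :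
    circlesCycle R ι ∈ LinearMap.ker (bd R (Circles ι) 0) := by
  have hface (i : ι) : face 0 (circleSimplex i) = face 1 (circleSimplex i) := by
    ext x : 1
    have hx : x = stdSimplex.vertex 0 := Subsingleton.elim _ _
    subst hx
    simp [face, circleSimplex, stdSimplex.map_vertex]
  simp [circlesCycle, bd_single, Fin.sum_univ_two, hface]

/-- The fundamental class `[∐ S¹] ∈ H₁(∐ S¹; R)`. -/
def circlesClass (R : Type*) [CommRing R] (ι : Type*) [Fintype ι] : Homology R (Circles ι) 0 :=
  Submodule.Quotient.mk ⟨circlesCycle R ι, circlesCycle_mem R ι⟩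

variable {X : Type*} [TopologicalSpace X] {ι : Type*}

/-- The gluing relation `(u, 0) ∼ γ(u)` of the mapping cylinder. -/
inductive CylRel (γ : C(Circles ι, X)) :
    X ⊕ (Circles ι × unitInterval) → X ⊕ (Circles ι × unitInterval) → Prop
  | glue (u : Circles ι) : CylRel γ (Sum.inr (u, 0)) (Sum.inl (γ u))

/-- The mapping cylinder `X_γ`, with the quotient topology. -/
abbrev Cyl (γ : C(Circles ι, X)) : Type _ := Quot (CylRel γ)

/-- The inclusion `∐ S¹ → X_γ`, `u ↦ (u, 1)`. -/
def cylTop (γ : C(Circles ι, X)) : C(Circles ι, Cyl γ) where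
  toFun u := Quot.mk _ (Sum.inr (u, 1))
  continuous_toFun := continuous_quot_mk.comp (by fun_prop)

lemma cylTop_injective (γ : C(Circles ι, X)) : Function.Injective (cylTop γ) := by
  classical
  let q : Cyl γ → Option (Circles ι) :=
    Quot.lift (Sum.elim (fun _ => none) fun p => if p.2 = 1 then some p.1 else none) <| by
      rintro _ _ ⟨u⟩
      simp
  intro u v h
  have h' : q (cylTop γ u) = q (cylTop γ v) := congrArg q h
  simpa [q, cylTop] using h'

/-- The element of `π₁(X, x₀)` given by a map `S¹ → X` sending `1` to `x₀`. -/
def loopClass {x₀ : X} (f : C(Circle, X)) (hf : f 1 = x₀) : FundamentalGroup X x₀ :=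
  FundamentalGroup.fromPath
    (Path.Homotopic.Quotient.mk ((circlePath.map f.continuous).cast hf.symm hf.symm))

/-- The free homotopy class of the loop `f` corresponds to the conjugacy class of `g`: up to a free
homotopy, `f` is a loop based at `x₀` in the class `g`. -/
def LoopCorresponds {x₀ : X} (f : C(Circle, X)) (g : FundamentalGroup X x₀) : Prop :=
  ∃ (f' : C(Circle, X)) (hf' : f' 1 = x₀), f.Homotopic f' ∧ loopClass f' hf' = g

/-- The collection of loops `γ` represents the integral conjugacy class `x`: there is a standard
representative `∑ᵢ λᵢ wᵢ` of `x`, with nonzero `λᵢ` and pairwise non-conjugate `wᵢ`, such that the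
`i`-th loop of `γ` corresponds to the conjugacy class of `wᵢ ^ λᵢ`. -/
def Represents [Fintype ι] {x₀ : X} (γ : C(Circles ι, X))
    (x : ConjChains (FundamentalGroup X x₀)) : Prop :=
  ∃ (w : ι → FundamentalGroup X x₀) (l : ι → ℤ),
    (∀ i, l i ≠ 0) ∧ (∀ i k, i ≠ k → ¬ IsConj (w i) (w k)) ∧
    conjClass (∑ i, Finsupp.single (w i) (l i)) = x ∧
    ∀ i, LoopCorresponds (γ.comp (circleIncl i)) (w i ^ l i)

/-- The homology `H₂(X, γ; R) = H₂(X_γ, ∐ S¹; R)` of the pair `(X, γ)`. -/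
abbrev H2 (R : Type*) [CommRing R] (γ : C(Circles ι, X)) : Type _ :=
  RelHomology R 1 (cylTop γ)

/-- The boundary map `∂ : H₂(X, γ; R) → H₁(∐ S¹; R)`. -/
def H2.boundary (R : Type*) [CommRing R] (γ : C(Circles ι, X)) :
    H2 R γ →ₗ[R] Homology R (Circles ι) 0 :=
  connecting R 0 (cylTop_injective γ)

/-- The relative Gromov seminorm of a rational class, seen as a real class. -/
def gromovNorm (γ : C(Circles ι, X)) (α : H2 ℚ γ) : ℝ≥0∞ :=
  l1Seminorm (toRealClass 1 (cylTop γ) α)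

end Loops

end GromovScl

end

noncomputable section

namespace GromovScl

/-! ### Products of commutators -/

section CommutatorLength

variable {G : Type*} [Group G]

/-! Both sides measure the cheapest way to bound the loops: scl counts handles of surfaces, the
seminorm counts triangles. One handle costs four triangles, which gives the factor 1/4. All other
costs depend only on the number of loops or of copies, and vanish after passing to powers and
dividing by the exponent.

Merging, splitting or conjugating summands changes commutator lengths of n-th powers by an amount
bounded independently of n (`Comparable`). So the scl of any representative equals that of the
formal sum of the elements g_i of the fundamental group read off from the loops
(`scl_eq_sclSum_loopElt`).

The seminorm is at most 4 scl (`iInf_gromovNorm_le_sclSum`): if the n-th powers have commutator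
length k, then the sum of the g_i^n has a filling of norm 4k + O(1) in the bar complex. Singular
triangles realize this filling in X, a few more triangles join it to the n-fold loops at the top of
the cylinder, and division by n gives a rational relative cycle bounding the fundamental class.

The converse (`sclSum_loopElt_le_gromovNorm`) goes through duality, as in Bavard's theorem. Let ψ be
an odd quasimorphism of defect at most one, within distance one of n ↦ n h_i on the powers of g_i.
The edges of singular simplices in the cylinder are straightened to group elements, and ψ is
averaged over many windings of the framing at each end. The resulting 1-cochain has coboundary at
most 1 and tends to h_i times the winding number on the i-th top circle; pairing it with a relative
cycle a gives ∑ h_i ≤ ‖a‖₁ (`sum_le_norm1`).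

Conversely, if ∑ h_i ≤ A for all such ψ, Hahn–Banach yields fillings of ½∑(g_i^N - g_i^(-N)) of norm
N A + O(1). These are made rational, their denominators are cleared by a factor D, and the triangles
are glued in pairs along their sides (`SumCommProd.of_barBd_eq`). The surface bounds 2D copies of
each g_i^N and has about 2DNA/4 handles. Merging the copies into g_i^(2DN) costs O(D), so the
quotient by 2DN approaches A/4 as N grows. -/

/-- `g` is a product of at most `k` commutators. -/
def IsCommProd (k : ℕ) (g : G) : Prop :=
  ∃ L : List (G × G), L.length ≤ k ∧ (L.map fun p => p.1 * p.2 * p.1⁻¹ * p.2⁻¹).prod = g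

lemma IsCommProd.mono {k l : ℕ} {g : G} (h : IsCommProd k g) (hkl : k ≤ l) : IsCommProd l g := by
  obtain ⟨L, hL, rfl⟩ := h
  exact ⟨L, hL.trans hkl, rfl⟩

lemma isCommProd_one (k : ℕ) : IsCommProd k (1 : G) := ⟨[], by simp, by simp⟩

lemma isCommProd_commutator (a b : G) : IsCommProd 1 (a * b * a⁻¹ * b⁻¹) :=
  ⟨[(a, b)], by simp, by simp⟩

lemma IsCommProd.mul {k l : ℕ} {g h : G} (hg : IsCommProd k g) (hh : IsCommProd l h) :
    IsCommProd (k + l) (g * h) := by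
  obtain ⟨L, hL, rfl⟩ := hg
  obtain ⟨M, hM, rfl⟩ := hh
  exact ⟨L ++ M, by simpa using Nat.add_le_add hL hM, by simp⟩

lemma IsCommProd.conj {k : ℕ} {g : G} (hg : IsCommProd k g) (t : G) :
    IsCommProd k (t * g * t⁻¹) := by
  obtain ⟨L, hL, rfl⟩ := hg
  refine ⟨L.map fun p => (t * p.1 * t⁻¹, t * p.2 * t⁻¹), by simpa using hL, ?_⟩
  rw [← MulAut.conj_apply, map_list_prod, List.map_map, List.map_map]
  congr 1
  refine List.map_congr_left fun p _ => ?_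
  simp [mul_assoc]

lemma commLength_le_iff {k : ℕ} {g : G} : commLength g ≤ k ↔ IsCommProd k g := by
  constructor
  · intro h
    have h' : commLength g < ((k + 1 : ℕ) : ℕ∞) := lt_of_le_of_lt h (by exact_mod_cast k.lt_succ_self)
    simp only [commLength, iInf_lt_iff] at h'
    obtain ⟨L, hL, hlt⟩ := h'
    exact ⟨L, Nat.lt_succ_iff.1 (by exact_mod_cast hlt), hL⟩
  · rintro ⟨L, hL, hg⟩
    exact (iInf₂_le L hg).trans (by exact_mod_cast hL)

/-- The formal sum of the entries of `L` has commutator length at most `k`: some product of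
conjugates of the entries is a product of at most `k` commutators. -/
def SumCommProd (k : ℕ) (L : List G) : Prop :=
  ∃ L' : List G, List.Forall₂ IsConj L L' ∧ IsCommProd k L'.prod

lemma commLengthSum_le_iff {k : ℕ} {L : List G} : commLengthSum L ≤ k ↔ SumCommProd k L := by
  constructor
  · intro h
    have h' : commLengthSum L < ((k + 1 : ℕ) : ℕ∞) :=
      lt_of_le_of_lt h (by exact_mod_cast k.lt_succ_self)
    simp only [commLengthSum, iInf_lt_iff] at h'
    obtain ⟨L', hL, hlt⟩ := h'
    refine ⟨L', hL, commLength_le_iff.1 ?_⟩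
    exact Order.le_of_lt_add_one (by exact_mod_cast hlt)
  · rintro ⟨L', hL, hg⟩
    exact (iInf₂_le L' hL).trans (commLength_le_iff.2 hg)

namespace SumCommProd

variable {k l : ℕ} {L M : List G} {x y : G}

lemma mono (h : SumCommProd k L) (hkl : k ≤ l) : SumCommProd l L := by
  obtain ⟨L', h1, h2⟩ := h
  exact ⟨L', h1, h2.mono hkl⟩

lemma nil (k : ℕ) : SumCommProd k ([] : List G) := ⟨[], .nil, isCommProd_one k⟩

lemma of_forall₂ (h : SumCommProd k L) (hLM : List.Forall₂ IsConj L M) : SumCommProd k M := by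
  obtain ⟨L', h1, h2⟩ := h
  refine ⟨L', ?_, h2⟩
  have : List.Forall₂ IsConj M L := hLM.flip.imp fun _ _ h => IsConj.symm h
  clear hLM h2
  induction this generalizing L' with
  | nil => exact h1
  | cons hab _ ih =>
    cases h1 with
    | cons hbc h1 => exact .cons (hab.trans hbc) (ih _ h1)

lemma append (h : SumCommProd k L) (h' : SumCommProd l M) : SumCommProd (k + l) (L ++ M) := by
  obtain ⟨L', h1, h2⟩ := h
  obtain ⟨M', h1', h2'⟩ := h'
  exact ⟨L' ++ M', List.rel_append h1 h1', by simpa using h2.mul h2'⟩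

/-- Neighbouring factors may be exchanged by conjugating one with the other, b a = (b a b⁻¹) b, and
conjugation is free in a formal sum. -/
lemma perm (h : SumCommProd k L) (hLM : L.Perm M) : SumCommProd k M := by
  obtain ⟨L', h1, h2⟩ := h
  suffices H : ∃ M', List.Forall₂ IsConj M M' ∧ M'.prod = L'.prod by
    obtain ⟨M', h3, h4⟩ := H
    exact ⟨M', h3, h4 ▸ h2⟩
  clear h2
  induction hLM generalizing L' with
  | nil => exact ⟨L', h1, rfl⟩
  | cons a _ ih =>
    cases h1 with
    | cons hab h1 =>
      obtain ⟨M', h3, h4⟩ := ih _ h1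
      exact ⟨_ :: M', .cons hab h3, by simp [h4]⟩
  | swap a b N =>
    cases h1 with
    | @cons _ b' _ _ hb h1 =>
      cases h1 with
      | @cons _ a' _ N' ha h1 =>
        refine ⟨b' * a' * b'⁻¹ :: b' :: N', .cons (ha.trans ?_) (.cons hb h1), ?_⟩
        · exact isConj_iff.2 ⟨b', rfl⟩
        · simp [mul_assoc]
  | trans _ _ ih1 ih2 =>
    obtain ⟨M', h3, h4⟩ := ih1 _ h1
    obtain ⟨N', h5, h6⟩ := ih2 _ h3
    exact ⟨N', h5, h6.trans h4⟩

lemma conj_cons (h : SumCommProd k (x :: L)) (hxy : IsConj x y) : SumCommProd k (y :: L) :=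
  h.of_forall₂ (.cons hxy (List.forall₂_same.2 fun _ _ => .refl _))

/-- One conjugator serves both factors, so splitting a boundary component costs no handle. Merging,
by contrast, has to reconcile two conjugators. -/
lemma split (h : SumCommProd k (x * y :: L)) : SumCommProd k (x :: y :: L) := by
  obtain ⟨_, h1, h2⟩ := h
  cases h1 with
  | @cons _ z _ L' hz h1 =>
    obtain ⟨t, rfl⟩ := isConj_iff.1 hz
    refine ⟨t * x * t⁻¹ :: t * y * t⁻¹ :: L', .cons (isConj_iff.2 ⟨t, rfl⟩)
      (.cons (isConj_iff.2 ⟨t, rfl⟩) h1), ?_⟩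
    simpa [mul_assoc] using h2

lemma drop_comm (a b : G) (h : SumCommProd k (a * b * a⁻¹ * b⁻¹ * x :: L)) :
    SumCommProd (k + 1) (x :: L) := by
  obtain ⟨_, h1, h2⟩ := h
  cases h1 with
  | @cons _ z _ L' hz h1 =>
    obtain ⟨t, rfl⟩ := isConj_iff.1 hz
    refine ⟨t * x * t⁻¹ :: L', .cons (isConj_iff.2 ⟨t, rfl⟩) h1, ?_⟩
    have := ((isCommProd_commutator b a).conj t).mul h2
    rw [add_comm] at this
    convert this using 1
    simp [mul_assoc]

/-- A product of arbitrary conjugates of x and y is, up to conjugacy, a conjugate of xy times a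
single commutator, whatever the two conjugators are. -/
lemma merge (h : SumCommProd k (x :: y :: L)) : SumCommProd (k + 1) (x * y :: L) := by
  obtain ⟨_, h1, h2⟩ := h
  cases h1 with
  | @cons _ x' _ _ hx h1 =>
    cases h1 with
    | @cons _ y' _ L' hy h1 =>
      obtain ⟨s, rfl⟩ := isConj_iff.1 hx
      obtain ⟨t, rfl⟩ := isConj_iff.1 hy
      have h3 : SumCommProd k ((s * x * s⁻¹) * (t * y * t⁻¹) :: L) :=
        ⟨_ :: L', .cons (.refl _) h1, by simpa [mul_assoc] using h2⟩
      have h4 : SumCommProd k ((s * y⁻¹ * s⁻¹) * (t * s⁻¹) * (s * y⁻¹ * s⁻¹)⁻¹ * (t * s⁻¹)⁻¹ *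
          (s * x * y * s⁻¹) :: L) :=
        h3.conj_cons (isConj_iff.2 ⟨(s * x * y * s⁻¹)⁻¹, by group⟩)
      exact (h4.drop_comm).conj_cons (isConj_iff.2 ⟨s⁻¹, by group⟩)

lemma cons_one (h : SumCommProd k L) : SumCommProd k (1 :: L) := by
  obtain ⟨L', h1, h2⟩ := h
  exact ⟨1 :: L', .cons (.refl _) h1, by simpa using h2⟩

lemma of_cons_one (h : SumCommProd k (1 :: L)) : SumCommProd k L := by
  obtain ⟨_, h1, h2⟩ := h
  cases h1 with
  | @cons _ x' _ L' hx h1 =>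
    rw [isConj_one_right.1 hx] at h2
    exact ⟨L', h1, by simpa using h2⟩

end SumCommProd

/-! ### Formal sums up to bounded error. -/

/-- Two formal sums are comparable: in every formal sum, replacing the `n`-th powers of the first
by those of the second changes the commutator length by an amount bounded independently of `n`. -/
def Comparable (L M : List G) : Prop :=
  ∃ C : ℕ, ∀ (n k : ℕ) (N : List G),
    (SumCommProd k (L.map (· ^ n) ++ N) → SumCommProd (k + C) (M.map (· ^ n) ++ N)) ∧
    (SumCommProd k (M.map (· ^ n) ++ N) → SumCommProd (k + C) (L.map (· ^ n) ++ N))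

namespace Comparable

variable {L M N L' M' : List G}

lemma symm (h : Comparable L M) : Comparable M L := by
  obtain ⟨C, hC⟩ := h
  exact ⟨C, fun n k N => (hC n k N).symm⟩

lemma trans (h : Comparable L M) (h' : Comparable M N) : Comparable L N := by
  obtain ⟨C, hC⟩ := h
  obtain ⟨D, hD⟩ := h'
  refine ⟨C + D, fun n k K => ⟨fun h => ?_, fun h => ?_⟩⟩
  · exact ((hD n _ K).1 ((hC n k K).1 h)).mono (by omega)
  · exact ((hC n _ K).2 ((hD n k K).2 h)).mono (by omega)

lemma of_perm (h : L.Perm M) : Comparable L M :=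
  ⟨0, fun _ _ _ => ⟨fun h' => h'.perm ((h.map _).append_right _),
    fun h' => h'.perm ((h.symm.map _).append_right _)⟩⟩

lemma append_left (h : Comparable L M) (K : List G) : Comparable (K ++ L) (K ++ M) := by
  obtain ⟨C, hC⟩ := h
  refine ⟨C, fun n k N => ?_⟩
  have key (A B : List G) : (A.map (· ^ n) ++ (B.map (· ^ n) ++ N)).Perm
      ((B ++ A).map (· ^ n) ++ N) := by
    rw [List.map_append, ← List.append_assoc]
    exact List.perm_append_comm.append_right _
  exact ⟨fun h => ((hC n k _).1 (h.perm (key L K).symm)).perm (key M K),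
    fun h => ((hC n k _).2 (h.perm (key M K).symm)).perm (key L K)⟩

lemma append_right (h : Comparable L M) (K : List G) : Comparable (L ++ K) (M ++ K) :=
  ((of_perm List.perm_append_comm).trans (h.append_left K)).trans (of_perm List.perm_append_comm)

lemma conj_pow {x y : G} (h : IsConj x y) (a : ℤ) : Comparable [x ^ a] [y ^ a] := by
  have h' (n : ℕ) : IsConj ((x ^ a) ^ n) ((y ^ a) ^ n) := by
    obtain ⟨t, rfl⟩ := isConj_iff.1 h
    exact isConj_iff.2 ⟨t, by rw [conj_zpow, _root_.conj_pow]⟩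
  exact ⟨0, fun n k N => ⟨fun H => SumCommProd.conj_cons H (h' n),
    fun H => SumCommProd.conj_cons H (h' n).symm⟩⟩

/-- Powers of x commute, so the n-th power of the product is the product of the n-th powers, and one
merge suffices for every n. -/
lemma pow_add (x : G) (a b : ℤ) : Comparable [x ^ a, x ^ b] [x ^ (a + b)] := by
  have h' (n : ℕ) : (x ^ (a + b)) ^ n = (x ^ a) ^ n * (x ^ b) ^ n := by
    rw [zpow_add, (Commute.refl x).zpow_zpow a b |>.mul_pow]
  refine ⟨1, fun n k N => ⟨fun H => ?_, fun H => ?_⟩⟩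
  · simpa [h'] using SumCommProd.merge H
  · have H' : SumCommProd k ((x ^ a) ^ n * (x ^ b) ^ n :: N) := by simpa [h'] using H
    exact H'.split.mono (by omega)

lemma one_nil : Comparable [(1 : G)] [] :=
  ⟨0, fun _ _ _ => ⟨fun H => SumCommProd.of_cons_one (by simpa using H),
    fun H => by simpa using SumCommProd.cons_one H⟩⟩

end Comparable

/-- A formal sum of powers of representatives of conjugacy classes. -/
def normalForm (e : ConjClasses G →₀ ℤ) : List G :=
  e.support.toList.map fun κ => κ.out ^ e κ

/-- Isolates one coefficient, allowing it to be zero, so that a new term can be added to it without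
distinguishing whether the class already occurs or cancels. -/
lemma comparable_normalForm (e : ConjClasses G →₀ ℤ) (κ : ConjClasses G) :
    Comparable (normalForm e) (κ.out ^ e κ :: normalForm (e.erase κ)) := by
  classical
  by_cases h : κ ∈ e.support
  · apply Comparable.of_perm
    have h1 : e.support.toList.Perm (κ :: (e.erase κ).support.toList) := by
      rw [Finsupp.support_erase]
      conv_lhs => rw [← Finset.insert_erase h]
      exact Finset.toList_insert (Finset.notMem_erase κ _)
    refine (h1.map _).trans ?_
    rw [List.map_cons, normalForm]
    refine List.Perm.cons _ (List.Perm.of_eq (List.map_congr_left fun κ' hκ' => ?_))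
    have : κ' ≠ κ := by
      rintro rfl
      simp at hκ'
    simp [Finsupp.erase_ne this]
  · have h0 : e κ = 0 := by simpa using h
    have h1 : e.erase κ = e := Finsupp.erase_of_notMem_support h
    rw [h0, h1, zpow_zero]
    exact (Comparable.one_nil.append_right (normalForm e)).symm

/-- Each term is moved to the chosen representative of its conjugacy class and its exponent is added
to the one already there. Hence scl depends only on the total coefficients of the conjugacy classes.
-/
lemma comparable_normalForm_sum (P : List (G × ℤ)) :
    Comparable (P.map fun p => p.1 ^ p.2)
      (normalForm (P.map fun p => Finsupp.single (ConjClasses.mk p.1) p.2).sum) := by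
  classical
  induction P with
  | nil => exact Comparable.of_perm (by simp [normalForm])
  | cons p P ih =>
    set e := (P.map fun p => Finsupp.single (ConjClasses.mk p.1) p.2).sum with he
    set κ := ConjClasses.mk p.1 with hκ
    have hout : IsConj p.1 κ.out := by
      rw [← ConjClasses.mk_eq_mk_iff_isConj, ← hκ]
      exact (Quotient.out_eq κ).symm
    simp only [List.map_cons, List.sum_cons, ← he, ← hκ]
    have h1 : Comparable (p.1 ^ p.2 :: P.map fun p => p.1 ^ p.2)
        ([κ.out ^ p.2] ++ normalForm e) :=
      ((Comparable.conj_pow hout p.2).append_right _).trans (ih.append_left _)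
    have h2 := h1.trans ((comparable_normalForm e κ).append_left [κ.out ^ p.2])
    have h3 := h2.trans ((Comparable.pow_add κ.out p.2 (e κ)).append_right
      (normalForm (e.erase κ)))
    refine h3.trans ?_
    have h4 := (comparable_normalForm (Finsupp.single κ p.2 + e) κ).symm
    have h5 : (Finsupp.single κ p.2 + e).erase κ = e.erase κ := by
      rw [Finsupp.erase_add, Finsupp.erase_single, zero_add]
    rw [h5] at h4
    simpa using h4

lemma mapDomain_eq_of_conjClass_eq {c c' : G →₀ ℤ} (h : conjClass c = conjClass c') :
    c.mapDomain ConjClasses.mk = c'.mapDomain ConjClasses.mk := by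
  have h1 : c - c' ∈ conjSubmodule G := (Submodule.Quotient.eq _).1 h
  have h2 : conjSubmodule G ≤ LinearMap.ker (Finsupp.lmapDomain ℤ ℤ (ConjClasses.mk (α := G))) := by
    refine Submodule.span_le.2 ?_
    rintro _ ⟨w, t, rfl⟩
    have : ConjClasses.mk (t⁻¹ * w * t) = ConjClasses.mk w :=
      ConjClasses.mk_eq_mk_iff_isConj.2 (isConj_iff.2 ⟨t, by group⟩)
    rw [SetLike.mem_coe, LinearMap.mem_ker, map_sub]
    simp [Finsupp.mapDomain_single, this]
  have h3 := LinearMap.mem_ker.1 (h2 h1)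
  rw [map_sub, sub_eq_zero] at h3
  exact h3

lemma liminf_le_liminf_of_le_add_div {f g : ℕ → ℝ≥0∞} {C : ℝ≥0∞} (hC : C ≠ ∞)
    (h : ∀ n : ℕ, n ≠ 0 → f n ≤ g n + C / n) :
    Filter.liminf f Filter.atTop ≤ Filter.liminf g Filter.atTop := by
  have h0 : Filter.Tendsto (fun n : ℕ => C / n) Filter.atTop (nhds 0) := by
    have := ENNReal.Tendsto.const_div ENNReal.tendsto_nat_nhds_top (.inr hC)
    simpa using this
  refine le_of_forall_lt_imp_le_of_dense fun y hy => ?_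
  refine ENNReal.le_of_forall_pos_le_add fun ε hε _ => ?_
  rw [← tsub_le_iff_right]
  refine Filter.le_liminf_of_le (by isBoundedDefault) ?_
  filter_upwards [Filter.eventually_lt_of_lt_liminf hy, Filter.eventually_ne_atTop 0,
    h0.eventually_le_const (show (0 : ℝ≥0∞) < ε by simpa using hε)] with n h1 h2 h3
  rw [tsub_le_iff_right]
  exact h1.le.trans ((h n h2).trans (by gcongr))

/-- The error is a constant independent of n, hence disappears after division by n. -/
lemma Comparable.sclSum_eq {L M : List G} (h : Comparable L M) : sclSum L = sclSum M := by
  have key {L M : List G} (h : Comparable L M) : sclSum L ≤ sclSum M := by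
    obtain ⟨C, hC⟩ := h
    refine liminf_le_liminf_of_le_add_div (C := C) (by simp) fun n hn => ?_
    rw [← ENNReal.add_div]
    gcongr
    have : commLengthSum (L.map (· ^ n)) ≤ commLengthSum (M.map (· ^ n)) + C := by
      induction hM : commLengthSum (M.map (· ^ n)) using ENat.recTopCoe with
      | top => simp
      | coe k =>
        have h1 := (hC n k []).2 (by simpa using commLengthSum_le_iff.1 hM.le)
        rw [List.append_nil] at h1
        exact_mod_cast commLengthSum_le_iff.2 h1
    exact_mod_cast ENat.toENNReal_le.2 this
  exact (key h).antisymm (key h.symm)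

/-- Stable commutator length of chains is computed by any integral combination representing the
same conjugacy class. -/
lemma scl_eq_of_conjClass_eq {ι : Type*} [Fintype ι] (w : ι → G) (l : ι → ℤ) (c : G →₀ ℤ)
    (h : conjClass (∑ i, Finsupp.single (w i) (l i)) = conjClass c) :
    scl c = sclSum ((Finset.univ : Finset ι).toList.map fun i => w i ^ l i) := by
  have h1 := comparable_normalForm_sum (c.support.toList.map fun g => (g, c g))
  have h2 := comparable_normalForm_sum ((Finset.univ : Finset ι).toList.map fun i => (w i, l i))
  simp only [List.map_map, Function.comp_def] at h1 h2
  have e1 : (c.support.toList.map fun g => Finsupp.single (ConjClasses.mk g) (c g)).sum =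
      c.mapDomain ConjClasses.mk := by
    rw [Finset.sum_map_toList]
    rfl
  have e2 : ((Finset.univ : Finset ι).toList.map
      fun i => Finsupp.single (ConjClasses.mk (w i)) (l i)).sum =
      (∑ i, Finsupp.single (w i) (l i)).mapDomain ConjClasses.mk := by
    rw [Finset.sum_map_toList, Finsupp.mapDomain_finsetSum]
    simp [Finsupp.mapDomain_single]
  rw [e1] at h1
  rw [e2, mapDomain_eq_of_conjClass_eq h] at h2
  exact (h1.trans h2.symm).sclSum_eq

end CommutatorLength

/-! ### Gluing polygons -/

section Gluing

variable {G : Type*}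

variable (G) in
/-- Letters labelling the sides of polygons: `inl (g, ε)` is an interior side, labelled by the edge
`g` with orientation `ε`, and `inr g` is a boundary side with label `g`. -/
abbrev Letter : Type _ := (G × Bool) ⊕ G

namespace Letter

/-- The value of a letter in the group. -/
def val [Group G] : Letter G → G
  | .inl (g, true) => g
  | .inl (g, false) => g⁻¹
  | .inr g => g

/-- The signed edge underlying a letter; boundary letters do not count. -/
def edge : Letter G → (G →₀ ℤ)
  | .inl (g, true) => Finsupp.single g 1
  | .inl (g, false) => -Finsupp.single g 1
  | .inr _ => 0

/-- The label of a boundary letter. -/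
def bdry? : Letter G → Option G
  | .inl _ => none
  | .inr g => some g

end Letter

/-- The product of the values of the letters of a word. -/
def wordVal [Group G] (W : List (Letter G)) : G := (W.map Letter.val).prod

/-- The signed count of the interior sides of a word. -/
def wordEdges (W : List (Letter G)) : G →₀ ℤ := (W.map Letter.edge).sum

/-- The labels of the boundary sides of a word. -/
def wordBdry (W : List (Letter G)) : List G := W.filterMap Letter.bdry?

variable (V W : List (Letter G)) (a : Letter G)

@[simp] lemma wordVal_nil [Group G] : wordVal ([] : List (Letter G)) = 1 := rfl
@[simp] lemma wordVal_cons [Group G] : wordVal (a :: W) = a.val * wordVal W := by simp [wordVal]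
@[simp] lemma wordVal_append [Group G] : wordVal (V ++ W) = wordVal V * wordVal W := by simp [wordVal]
@[simp] lemma wordEdges_nil : wordEdges ([] : List (Letter G)) = 0 := rfl
@[simp] lemma wordEdges_cons : wordEdges (a :: W) = a.edge + wordEdges W := by simp [wordEdges]
@[simp] lemma wordEdges_append : wordEdges (V ++ W) = wordEdges V + wordEdges W := by
  simp [wordEdges]
@[simp] lemma wordBdry_nil : wordBdry ([] : List (Letter G)) = [] := rfl
@[simp] lemma wordBdry_inl (p : G × Bool) : wordBdry (.inl p :: W) = wordBdry W := by
  rfl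
@[simp] lemma wordBdry_inr (g : G) : wordBdry (.inr g :: W) = g :: wordBdry W := by
  rfl
@[simp] lemma wordBdry_append : wordBdry (V ++ W) = wordBdry V ++ wordBdry W := by
  simp [wordBdry]

@[simp] lemma Letter.val_not [Group G] (g : G) (ε : Bool) :
    Letter.val (.inl (g, !ε)) = (Letter.val (.inl (g, ε)))⁻¹ := by
  cases ε <;> simp [Letter.val]

@[simp] lemma Letter.edge_not (g : G) (ε : Bool) :
    Letter.edge (.inl (g, !ε)) = -Letter.edge (.inl (g, ε)) := by
  cases ε <;> simp [Letter.edge]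

variable {V W}

/-- A word whose signed count of `g` is positive contains the letter `g`, and similarly for
negative counts. -/
lemma wordEdges_sign_mem {g : G} :
    (0 < wordEdges W g → .inl (g, true) ∈ W) ∧ (wordEdges W g < 0 → .inl (g, false) ∈ W) := by
  classical
  induction W with
  | nil => simp
  | cons a W ih =>
    rw [wordEdges_cons, Finsupp.add_apply]
    rcases a with ⟨h, _ | _⟩ | h
    · by_cases hg : h = g
      · subst hg
        simp only [Letter.edge, Finsupp.neg_apply, Finsupp.single_eq_same, List.mem_cons]
        exact ⟨fun h => .inr (ih.1 (by omega)), fun h => .inl trivial⟩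
      · simp only [Letter.edge, Finsupp.neg_apply, Finsupp.single_eq_of_ne (Ne.symm hg), neg_zero,
          zero_add, List.mem_cons]
        exact ⟨fun h => .inr (ih.1 h), fun h => .inr (ih.2 h)⟩
    · by_cases hg : h = g
      · subst hg
        simp only [Letter.edge, Finsupp.single_eq_same, List.mem_cons]
        exact ⟨fun h => .inl trivial, fun h => .inr (ih.2 (by omega))⟩
      · simp only [Letter.edge, Finsupp.single_eq_of_ne (Ne.symm hg), zero_add, List.mem_cons]
        exact ⟨fun h => .inr (ih.1 h), fun h => .inr (ih.2 h)⟩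
    · simp only [Letter.edge, Finsupp.coe_zero, Pi.zero_apply, zero_add, List.mem_cons]
      exact ⟨fun h => .inr (ih.1 h), fun h => .inr (ih.2 h)⟩

/-- If two words cancel, and the first does not cancel by itself, then they contain a pair of
opposite letters. -/
lemma exists_opposite_mem (h : wordEdges V + wordEdges W = 0) (hV : wordEdges V ≠ 0) :
    ∃ (g : G) (ε : Bool), .inl (g, ε) ∈ V ∧ .inl (g, !ε) ∈ W := by
  obtain ⟨g, hg⟩ := Finsupp.ne_iff.1 hV
  have h' : wordEdges V g + wordEdges W g = 0 := by
    rw [← Finsupp.add_apply, h]; rfl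
  rcases lt_or_gt_of_ne hg with hg | hg
  · exact ⟨g, false, wordEdges_sign_mem.2 hg,
      wordEdges_sign_mem.1 (by simp only [Finsupp.coe_zero, Pi.zero_apply] at hg; omega)⟩
  · exact ⟨g, true, wordEdges_sign_mem.1 hg,
      wordEdges_sign_mem.2 (by simp only [Finsupp.coe_zero, Pi.zero_apply] at hg; omega)⟩

lemma wordEdges_perm (h : V.Perm W) : wordEdges V = wordEdges W := (h.map _).sum_eq

lemma wordBdry_perm (h : V.Perm W) : (wordBdry V).Perm (wordBdry W) := h.filterMap _

lemma length_wordBdry_le : (wordBdry W).length ≤ W.length := List.length_filterMap_le _ _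

variable [Group G]

/-- Splitting a word without interior sides into its letters. -/
lemma SumCommProd.split_word {k : ℕ} {L : List G} (hW : ∀ p, Sum.inl p ∉ W)
    (h : SumCommProd k (wordVal W :: L)) : SumCommProd k (wordBdry W ++ L) := by
  induction W generalizing L with
  | nil => exact SumCommProd.of_cons_one h
  | cons a W ih =>
    rcases a with p | g
    · exact absurd (List.mem_cons_self ..) (hW p)
    · rw [wordVal_cons] at h
      have h2 := ih (L := g :: L) (fun p hp => hW p (List.mem_cons_of_mem _ hp))
        (h.split.perm (List.Perm.swap _ _ _))
      rw [wordBdry_inr]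
      exact h2.perm List.perm_middle

/-- Gluing the sides of a polygon in pairs. -/
lemma SumCommProd.glue_polygon (W : List (Letter G)) (hW : wordEdges W = 0) :
    ∃ k : ℕ, 4 * k + (wordBdry W).length ≤ W.length ∧ ∀ (j : ℕ) (L : List G),
      SumCommProd j (wordVal W :: L) → SumCommProd (j + k) (wordBdry W ++ L) := by
  induction hn : W.length using Nat.strong_induction_on generalizing W with
  | _ n ih =>
  subst hn
  by_cases hin : ∀ p, Sum.inl p ∉ W
  · exact ⟨0, by simpa using length_wordBdry_le, fun j L h => h.split_word hin⟩
  push Not at hin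
  obtain ⟨⟨x, ε⟩, hx⟩ := hin
  obtain ⟨A, Z, rfl⟩ := List.append_of_mem hx
  have hopp : Sum.inl (x, !ε) ∈ Z ++ A := by
    have h1 : Letter.edge (.inl (x, ε)) + wordEdges (Z ++ A) = 0 := by
      simp only [wordEdges_append, wordEdges_cons] at hW ⊢
      rw [← hW]; abel
    obtain ⟨g, δ, h2, h3⟩ := exists_opposite_mem (V := [.inl (x, ε)]) (W := Z ++ A)
      (by simpa using h1) (by cases ε <;> simp [Letter.edge])
    simp only [List.mem_singleton, Sum.inl.injEq, Prod.mk.injEq] at h2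
    rwa [h2.1, h2.2] at h3
  obtain ⟨B, C, hBC⟩ := List.append_of_mem hopp
  have hperm : (A ++ .inl (x, ε) :: Z).Perm (.inl (x, ε) :: (B ++ .inl (x, !ε) :: C)) := by
    rw [← hBC]
    exact List.perm_append_comm
  have hlen := hperm.length_eq
  have hbd : (wordBdry (A ++ .inl (x, ε) :: Z)).Perm (wordBdry B ++ wordBdry C) := by
    simpa using wordBdry_perm hperm
  have hedge : wordEdges B + wordEdges C = 0 := by
    rw [wordEdges_perm hperm] at hW
    simp only [wordEdges_append, wordEdges_cons, Letter.edge_not] at hW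
    rw [← hW]; abel
  have hval : IsConj (wordVal (A ++ .inl (x, ε) :: Z))
      (wordVal (.inl (x, ε) :: (B ++ .inl (x, !ε) :: C))) := by
    rw [← hBC]
    exact isConj_iff.2 ⟨(wordVal A)⁻¹, by simp [mul_assoc]⟩
  set X := Letter.val (.inl (x, ε)) with hX
  simp only [wordVal_cons, wordVal_append, Letter.val_not, ← hX] at hval
  have hbdlen := hbd.length_eq
  simp only [List.length_append, List.length_cons] at hlen hbdlen
  -- The word is cyclically x B x⁻¹ C. If B cancels by itself, so does C, and gluing the two x-sides
  -- separates the boundary into B and C at no cost. Otherwise some pair y, y⁻¹ is linked with x,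
  -- x⁻¹, and gluing both pairs creates a handle.
  by_cases hB : wordEdges B = 0
  · have hC : wordEdges C = 0 := by simpa [hB] using hedge
    obtain ⟨k, hk, hk'⟩ := ih B.length (by simp; omega) B hB rfl
    obtain ⟨l, hl, hl'⟩ := ih C.length (by simp; omega) C hC rfl
    refine ⟨k + l, by simp only [List.length_append, List.length_cons]; omega, fun j L h => ?_⟩
    have h1 : SumCommProd j ((X * wordVal B * X⁻¹) * wordVal C :: L) := by
      refine h.conj_cons ?_
      rw [wordVal_append, wordVal_cons]
      simpa [mul_assoc] using hval
    have h2 := hk' _ _ (h1.split.conj_cons (isConj_iff.2 ⟨X⁻¹, by group⟩))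
    have h3 := hl' _ _ (h2.perm List.perm_middle)
    rw [← add_assoc]
    refine h3.perm ?_
    rw [← List.append_assoc]
    exact (List.perm_append_comm.trans hbd.symm).append_right _
  · obtain ⟨y, δ, hy, hy'⟩ := exists_opposite_mem hedge hB
    obtain ⟨B₁, B₂, rfl⟩ := List.append_of_mem hy
    obtain ⟨C₁, C₂, rfl⟩ := List.append_of_mem hy'
    -- The boundary left after removing the handle formed by the linked pairs: four sides are lost
    -- and one commutator is spent, matching the 4k in the bound.
    set W' := C₂ ++ C₁ ++ B₂ ++ B₁ with hW'
    simp only [List.length_append, List.length_cons] at hlen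
    have hedge' : wordEdges W' = 0 := by
      simp only [wordEdges_append, wordEdges_cons, Letter.edge_not, hW'] at hedge ⊢
      rw [← hedge]; abel
    have hlen' : W'.length + 4 = (A ++ .inl (x, ε) :: Z).length := by
      simp only [hW', List.length_append, List.length_cons]; omega
    obtain ⟨k, hk, hk'⟩ := ih W'.length (by omega) W' hedge' rfl
    have hbd' : (wordBdry W').Perm (wordBdry (A ++ .inl (x, ε) :: Z)) := by
      refine List.Perm.trans ?_ hbd.symm
      classical
      rw [List.perm_iff_count]
      intro g
      simp only [hW', wordBdry_append, wordBdry_inl, List.count_append]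
      omega
    have hbl := hbd'.length_eq
    refine ⟨k + 1, by omega, fun j L h => ?_⟩
    set Y := Letter.val (.inl (y, δ)) with hY
    simp only [wordVal_append, wordVal_cons, Letter.val_not, ← hY] at hval
    have h1 : SumCommProd j (X * (wordVal B₁ * (Y * wordVal B₂) *
        (X⁻¹ * (wordVal C₁ * (Y⁻¹ * wordVal C₂)))) :: L) := h.conj_cons (by
      rw [wordVal_append, wordVal_cons]
      exact hval)
    -- These elements are chosen so that conjugating the word by d⁻¹ writes it as one commutator
    -- times the value of W'.
    set d := wordVal C₁ * wordVal B₂ * wordVal B₁ with hd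
    set s := (X * wordVal B₁)⁻¹ * d with hs
    set q := Y * wordVal B₂ * wordVal B₁ with hq
    have h2 : SumCommProd j (s⁻¹ * q * s⁻¹⁻¹ * q⁻¹ * (wordVal C₂ * d) :: L) :=
      h1.conj_cons (isConj_iff.2 ⟨d⁻¹, by simp only [hs, hq, hd]; group⟩)
    have h3 : SumCommProd (j + 1) (wordVal W' :: L) := by
      simpa [hW', hd, mul_assoc] using h2.drop_comm
    rw [add_comm k 1, ← add_assoc]
    exact (hk' _ _ h3).perm (hbd'.append_right _)

/-- Gluing the sides of a collection of polygons in pairs. -/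
lemma SumCommProd.glue_polygons (WW : List (List (Letter G))) (hval : ∀ W ∈ WW, wordVal W = 1)
    (hlen : ∀ W ∈ WW, 2 ≤ W.length) (hedge : wordEdges WW.flatten = 0) :
    ∃ k : ℕ, 4 * k + 2 * WW.length ≤ WW.flatten.length + 2 * (wordBdry WW.flatten).length ∧
      SumCommProd k (wordBdry WW.flatten) := by
  induction hn : WW.length using Nat.strong_induction_on generalizing WW with
  | _ n ih =>
  subst hn
  rcases WW with _ | ⟨W, rest⟩
  · exact ⟨0, by simp, SumCommProd.nil 0⟩
  rw [List.flatten_cons, wordEdges_append] at hedge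
  have hW1 := hval W (List.mem_cons_self ..)
  have hW2 := hlen W (List.mem_cons_self ..)
  by_cases hW : wordEdges W = 0
  · obtain ⟨k, hk, hk'⟩ := ih rest.length (by simp) rest
      (fun V hV => hval V (List.mem_cons_of_mem _ hV))
      (fun V hV => hlen V (List.mem_cons_of_mem _ hV)) (by simpa [hW] using hedge) rfl
    -- A component without boundary is discarded; its contribution 2 to the left side is covered
    -- because its polygon has at least two sides. A component with boundary is closed up by gluing
    -- its single polygon.
    rcases hb : wordBdry W with _ | ⟨g, b⟩
    · refine ⟨k, ?_, ?_⟩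
      · simp only [List.flatten_cons, wordBdry_append, hb, List.length_append, List.length_cons,
          List.nil_append]
        omega
      · simpa [hb] using hk'
    · obtain ⟨l, hl, hl'⟩ := SumCommProd.glue_polygon W hW
      have h1 := hl' 0 [] (by rw [hW1]; exact (SumCommProd.nil 0).cons_one)
      rw [zero_add, List.append_nil] at h1
      refine ⟨l + k, ?_, by simpa using h1.append hk'⟩
      simp only [hb, List.length_cons] at hl
      simp only [List.flatten_cons, wordBdry_append, hb, List.length_append, List.length_cons]
      omega
  -- An unmatched side of W has its partner on another polygon V. Gluing along it gives one polygon,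
  -- again of trivial value, with two sides fewer, so the inequality is preserved.
  · obtain ⟨y, δ, hy, hy'⟩ := exists_opposite_mem hedge hW
    obtain ⟨V, hV, hyV⟩ := List.mem_flatten.1 hy'
    have hV1 := hval V (List.mem_cons_of_mem _ hV)
    have hV2 := hlen V (List.mem_cons_of_mem _ hV)
    obtain ⟨r₁, r₂, rfl⟩ := List.append_of_mem hV
    obtain ⟨A, B, rfl⟩ := List.append_of_mem hy
    obtain ⟨C, D, rfl⟩ := List.append_of_mem hyV
    have hbd : (wordBdry ((A ++ D ++ C ++ B) :: (r₁ ++ r₂)).flatten).Perm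
        (wordBdry ((A ++ .inl (y, δ) :: B) ::
          (r₁ ++ (C ++ .inl (y, !δ) :: D) :: r₂)).flatten) := by
      classical
      rw [List.perm_iff_count]
      intro g
      simp only [List.flatten_cons, List.flatten_append, wordBdry_append, wordBdry_inl,
        List.count_append]
      omega
    have hbl := hbd.length_eq
    obtain ⟨k, hk, hk'⟩ := ih ((A ++ D ++ C ++ B) :: (r₁ ++ r₂)).length
      (by simp) ((A ++ D ++ C ++ B) :: (r₁ ++ r₂)) (by
        intro U hU
        rcases List.mem_cons.1 hU with rfl | hU
        · simp only [wordVal_append, wordVal_cons, Letter.val_not] at hW1 hV1 ⊢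
          have : wordVal D * wordVal C = Letter.val (.inl (y, δ)) := by
            have h1 := eq_inv_of_mul_eq_one_left hV1
            rw [h1]; group
          rw [mul_assoc (wordVal A), this, mul_assoc]
          exact hW1
        · refine hval U ?_
          simp only [List.mem_append, List.mem_cons] at hU ⊢
          tauto) (by
        intro U hU
        rcases List.mem_cons.1 hU with rfl | hU
        · simp only [List.length_append, List.length_cons] at hW2 hV2 ⊢
          omega
        · refine hlen U ?_
          simp only [List.mem_append, List.mem_cons] at hU ⊢
          tauto) (by
        simp only [List.flatten_cons, List.flatten_append, wordEdges_append, wordEdges_cons,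
          Letter.edge_not] at hedge ⊢
        rw [← hedge]; abel) rfl
    refine ⟨k, ?_, hk'.perm hbd⟩
    rw [hbl] at hk
    simp only [List.flatten_cons, List.flatten_append, List.length_append, List.length_cons]
      at hk ⊢
    omega

end Gluing

/-! ### The bar complex in low degrees -/

section Norm

variable {S T R : Type*} [CommRing R] [LinearOrder R]

/-- The `ℓ¹`-norm of a finitely supported function. -/
def norm1 (b : S →₀ R) : R := b.sum fun _ r => |r|

@[simp] lemma norm1_zero : norm1 (0 : S →₀ R) = 0 := rfl

variable [IsStrictOrderedRing R]

@[simp] lemma norm1_single (s : S) (r : R) : norm1 (Finsupp.single s r) = |r| := by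
  simp [norm1]

lemma norm1_eq_sum (b : S →₀ R) {t : Finset S} (h : b.support ⊆ t) :
    norm1 b = ∑ s ∈ t, |b s| :=
  Finsupp.sum_of_support_subset _ h _ (by simp)

lemma norm1_nonneg (b : S →₀ R) : 0 ≤ norm1 b := Finset.sum_nonneg fun _ _ => abs_nonneg _

lemma norm1_add_le (a b : S →₀ R) : norm1 (a + b) ≤ norm1 a + norm1 b := by
  classical
  rw [norm1_eq_sum (a + b) Finsupp.support_add, norm1_eq_sum a Finset.subset_union_left,
    norm1_eq_sum b Finset.subset_union_right, ← Finset.sum_add_distrib]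
  exact Finset.sum_le_sum fun s _ => abs_add_le _ _

@[simp] lemma norm1_neg (a : S →₀ R) : norm1 (-a) = norm1 a := by
  simp [norm1, Finsupp.sum_neg_index]

lemma norm1_sub_le (a b : S →₀ R) : norm1 (a - b) ≤ norm1 a + norm1 b := by
  rw [sub_eq_add_neg]
  simpa using norm1_add_le a (-b)

lemma norm1_smul (r : R) (a : S →₀ R) : norm1 (r • a) = |r| * norm1 a := by
  rw [norm1_eq_sum (r • a) Finsupp.support_smul, norm1_eq_sum a subset_rfl, Finset.mul_sum]
  simp [abs_mul]

lemma norm1_sum_le {ι : Type*} (s : Finset ι) (f : ι → S →₀ R) :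
    norm1 (∑ i ∈ s, f i) ≤ ∑ i ∈ s, norm1 (f i) := by
  classical
  induction s using Finset.induction_on with
  | empty => simp
  | insert i s hi ih =>
    rw [Finset.sum_insert hi, Finset.sum_insert hi]
    exact (norm1_add_le _ _).trans (by gcongr)

lemma norm1_mapDomain_le (f : S → T) (a : S →₀ R) : norm1 (a.mapDomain f) ≤ norm1 a := by
  rw [Finsupp.mapDomain, Finsupp.sum]
  refine (norm1_sum_le _ _).trans (le_of_eq ?_)
  simp only [norm1_single]
  rfl

lemma abs_linearCombination_le {C : R} (f : S → R) (hf : ∀ s, |f s| ≤ C) (a : S →₀ R) :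
    |Finsupp.linearCombination R f a| ≤ C * norm1 a := by
  rw [Finsupp.linearCombination_apply, Finsupp.sum, norm1, Finsupp.sum, Finset.mul_sum]
  refine (Finset.abs_sum_le_sum_abs _ _).trans (Finset.sum_le_sum fun s _ => ?_)
  rw [smul_eq_mul, abs_mul, mul_comm]
  exact mul_le_mul_of_nonneg_right (hf s) (abs_nonneg _)

end Norm

section Bar

variable {G : Type*} [Group G]

variable (G) in
/-- The boundary map from degree two to degree one in the bar complex. -/
def barBd (R : Type*) [CommRing R] : (G × G →₀ R) →ₗ[R] (G →₀ R) :=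
  Finsupp.linearCombination R fun p =>
    Finsupp.single p.1 1 + Finsupp.single p.2 1 - Finsupp.single (p.1 * p.2) 1

lemma barBd_single {R : Type*} [CommRing R] (a b : G) (r : R) :
    barBd G R (Finsupp.single (a, b) r) =
      r • (Finsupp.single a 1 + Finsupp.single b 1 - Finsupp.single (a * b) 1) := by
  simp [barBd]

/-- The prefix d is multiplied successively by x, y, x⁻¹, y⁻¹, one triangle each. The edges x and y
occur once with each sign and cancel, so a commutator costs exactly four triangles and the
boundaries telescope along the list. -/
lemma exists_barBd_eq_prod_commutators (L : List (G × G)) (d : G) :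
    ∃ b : G × G →₀ ℚ, barBd G ℚ b = Finsupp.single d 1 -
        Finsupp.single (d * (L.map fun p => p.1 * p.2 * p.1⁻¹ * p.2⁻¹).prod) 1 ∧
      norm1 b ≤ 4 * L.length := by
  induction L generalizing d with
  | nil => exact ⟨0, by simp, by simp⟩
  | cons p L ih =>
    obtain ⟨x, y⟩ := p
    obtain ⟨b, hb, hn⟩ := ih (d * (x * y * x⁻¹ * y⁻¹))
    refine ⟨b + ((Finsupp.single (d, x) 1 + Finsupp.single (d * x, y) 1) -
      (Finsupp.single (d * x * y * x⁻¹, x) 1 +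
        Finsupp.single (d * x * y * x⁻¹ * y⁻¹, y) 1)), ?_, ?_⟩
    · simp only [map_add, map_sub, hb, barBd_single, one_smul, List.map_cons, List.prod_cons]
      simp only [mul_assoc, inv_mul_cancel, mul_one]
      abel
    · have h1 := norm1_add_le (Finsupp.single (d, x) (1 : ℚ)) (Finsupp.single (d * x, y) 1)
      have h2 := norm1_add_le (Finsupp.single (d * x * y * x⁻¹, x) (1 : ℚ))
        (Finsupp.single (d * x * y * x⁻¹ * y⁻¹, y) 1)
      have h3 := norm1_sub_le (Finsupp.single (d, x) (1 : ℚ) + Finsupp.single (d * x, y) 1)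
        (Finsupp.single (d * x * y * x⁻¹, x) (1 : ℚ) +
          Finsupp.single (d * x * y * x⁻¹ * y⁻¹, y) 1)
      refine (norm1_add_le _ _).trans ?_
      simp only [norm1_single, abs_one, List.length_cons, Nat.cast_add, Nat.cast_one] at *
      linarith

/-- Each summand needs two triangles for the conjugation t x = (t x t⁻¹) t and one for the
multiplication. The cost does not depend on the elements, so it stays fixed when they are replaced
by powers. -/
lemma exists_barBd_eq_sum_sub_prod {L L' : List G} (h : List.Forall₂ IsConj L L') :
    ∃ b : G × G →₀ ℚ, barBd G ℚ b = (L.map fun g => Finsupp.single g (1 : ℚ)).sum -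
        Finsupp.single L'.prod 1 ∧ norm1 b ≤ 3 * L.length + 1 := by
  induction h with
  | nil => exact ⟨-Finsupp.single (1, 1) 1, by simp [barBd_single], by simp⟩
  | @cons x x' L L' hx _ ih =>
    obtain ⟨b, hb, hn⟩ := ih
    obtain ⟨t, rfl⟩ := isConj_iff.1 hx
    refine ⟨b + ((Finsupp.single (t, x) 1 - Finsupp.single (t * x * t⁻¹, t) 1) +
      Finsupp.single (t * x * t⁻¹, L'.prod) 1), ?_, ?_⟩
    · simp only [map_add, map_sub, hb, barBd_single, one_smul, List.map_cons, List.prod_cons,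
        List.sum_cons]
      simp only [mul_assoc, inv_mul_cancel, mul_one]
      abel
    · have h1 := norm1_sub_le (Finsupp.single (t, x) (1 : ℚ)) (Finsupp.single (t * x * t⁻¹, t) 1)
      have h2 := norm1_add_le (Finsupp.single (t, x) (1 : ℚ) - Finsupp.single (t * x * t⁻¹, t) 1)
        (Finsupp.single (t * x * t⁻¹, L'.prod) 1)
      refine (norm1_add_le _ _).trans ?_
      simp only [norm1_single, abs_one, List.length_cons, Nat.cast_add, Nat.cast_one] at *
      linarith

/-- Formal sums of small commutator length have small fillings. -/
lemma SumCommProd.exists_barBd_eq {k : ℕ} {L : List G} (h : SumCommProd k L) :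
    ∃ b : G × G →₀ ℚ, barBd G ℚ b = (L.map fun g => Finsupp.single g (1 : ℚ)).sum ∧
      norm1 b ≤ 4 * k + 3 * L.length + 2 := by
  obtain ⟨L', hL, M, hM, hprod⟩ := h
  obtain ⟨b, hb, hbn⟩ := exists_barBd_eq_sum_sub_prod hL
  obtain ⟨b', hb', hbn'⟩ := exists_barBd_eq_prod_commutators M 1
  -- The boundary of (1, 1) is the edge 1; it absorbs the starting point of the commutator product.
  refine ⟨b + (Finsupp.single (1, 1) 1 - b'), ?_, ?_⟩
  · simp only [map_add, map_sub, hb, hb', barBd_single, hprod, one_mul, one_smul]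
    abel
  · have h1 := norm1_add_le b (Finsupp.single (1, 1) 1 - b')
    have h2 := norm1_sub_le (Finsupp.single ((1 : G), (1 : G)) (1 : ℚ)) b'
    have h3 : (M.length : ℚ) ≤ k := by exact_mod_cast hM
    simp only [norm1_single, abs_one] at h2
    linarith

/-- An integral chain in the bar complex is a union of triangles. -/
lemma exists_triangles (z : G × G →₀ ℤ) : ∃ WW : List (List (Letter G)),
    (∀ W ∈ WW, wordVal W = 1) ∧ (∀ W ∈ WW, 2 ≤ W.length) ∧ WW.flatten.length = 3 * WW.length ∧
      wordBdry WW.flatten = [] ∧ (WW.length : ℤ) = norm1 z ∧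
      wordEdges WW.flatten = barBd G ℤ z := by
  classical
  have hrep (n : ℕ) (W : List (Letter G)) :
      wordEdges (List.replicate n W).flatten = n • wordEdges W := by
    induction n with
    | zero => simp
    | succ n ih => rw [List.replicate_succ, List.flatten_cons, wordEdges_append, ih, succ_nsmul']
  have hrepb (n : ℕ) (W : List (Letter G)) (hW : wordBdry W = []) :
      wordBdry (List.replicate n W).flatten = [] := by
    induction n with
    | zero => simp
    | succ n ih => rw [List.replicate_succ, List.flatten_cons, wordBdry_append, ih, hW]; rfl
  induction z using Finsupp.induction with
  | zero => exact ⟨[], by simp⟩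
  | single_add p r z hp hr ih =>
    obtain ⟨WW, h1, h2, h3, h4, h5, h6⟩ := ih
    obtain ⟨x, y⟩ := p
    have hn : norm1 (Finsupp.single (x, y) r + z) = |r| + norm1 z := by
      rw [norm1, Finsupp.sum_add_index_of_disjoint, ← norm1, ← norm1, norm1_single]
      rw [Finsupp.support_single _ hr]
      simpa using hp
    obtain ⟨W, hW1, hW2, hW3, hW4⟩ : ∃ W : List (Letter G), wordVal W = 1 ∧ W.length = 3 ∧
        wordBdry W = [] ∧ r.natAbs • wordEdges W = barBd G ℤ (Finsupp.single (x, y) r) := by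
      rcases lt_or_gt_of_ne hr with h | h
      · refine ⟨[.inl (x * y, true), .inl (y, false), .inl (x, false)], ?_, rfl, rfl, ?_⟩
        · simp [Letter.val]
        · rw [barBd_single, ← natCast_zsmul, Int.natCast_natAbs, abs_of_neg h]
          simp only [wordEdges_cons, wordEdges_nil, Letter.edge, neg_smul, ← smul_neg]
          congr 1
          abel
      · refine ⟨[.inl (x, true), .inl (y, true), .inl (x * y, false)], ?_, rfl, rfl, ?_⟩
        · simp [Letter.val]
        · rw [barBd_single, ← natCast_zsmul, Int.natCast_natAbs, abs_of_pos h]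
          simp only [wordEdges_cons, wordEdges_nil, Letter.edge]
          congr 1
          abel
    refine ⟨List.replicate r.natAbs W ++ WW, ?_, ?_, ?_, ?_, ?_, ?_⟩
    · intro V hV
      rcases List.mem_append.1 hV with hV | hV
      · rw [List.eq_of_mem_replicate hV, hW1]
      · exact h1 V hV
    · intro V hV
      rcases List.mem_append.1 hV with hV | hV
      · rw [List.eq_of_mem_replicate hV, hW2]; norm_num
      · exact h2 V hV
    · simp only [List.flatten_append, List.length_append, h3, List.length_replicate,
        List.length_flatten, List.map_replicate, List.sum_replicate, hW2, smul_eq_mul]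
      simp only [List.length_flatten] at h3
      omega
    · rw [List.flatten_append, wordBdry_append, h4, hrepb _ _ hW3]; rfl
    · rw [hn, List.length_append, List.length_replicate, Nat.cast_add, h5, Int.natCast_natAbs]
    · rw [List.flatten_append, wordEdges_append, h6, hrep, hW4, map_add]

/-- Formal sums with small integral fillings have small commutator length. -/
lemma SumCommProd.of_barBd_eq (z : G × G →₀ ℤ) (B : List (G × Bool))
    (h : barBd G ℤ z = wordEdges (B.map Sum.inl)) :
    ∃ k : ℕ, 4 * (k : ℤ) ≤ norm1 z + 2 * B.length ∧
      SumCommProd k (B.map fun p => Letter.val (.inl p)) := by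
  obtain ⟨WW, h1, h2, h3, h4, h5, h6⟩ := exists_triangles z
  -- A bigon is attached along each boundary edge; its second side carries the boundary label. The
  -- polygons then have 3‖z‖ + 2|B| sides in total and number ‖z‖ + |B|, so
  -- `SumCommProd.glue_polygons` gives 4k ≤ ‖z‖ + 2|B|.
  set BB : List (List (Letter G)) :=
    B.map fun p => [.inl (p.1, !p.2), .inr (Letter.val (.inl p))] with hBB
  have e1 : wordEdges BB.flatten = -wordEdges (B.map Sum.inl) := by
    rw [hBB]
    clear h hBB BB
    induction B with
    | nil => simp
    | cons p B ih =>
      simp only [List.map_cons, List.flatten_cons, wordEdges_append, ih, wordEdges_cons,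
        Letter.edge_not, wordEdges_nil]
      simp only [Letter.edge]
      abel
  have e2 : wordBdry BB.flatten = B.map fun p => Letter.val (.inl p) := by
    rw [hBB]
    clear h hBB BB e1
    induction B with
    | nil => simp
    | cons p B ih => simp [ih]
  have e3 : BB.flatten.length = 2 * B.length := by
    simp [hBB, List.length_flatten, Function.comp_def, mul_comm]
  obtain ⟨k, hk, hk'⟩ := SumCommProd.glue_polygons (WW ++ BB)
    (by
      intro W hW
      rcases List.mem_append.1 hW with hW | hW
      · exact h1 W hW
      · obtain ⟨p, -, rfl⟩ := List.mem_map.1 hW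
        rw [wordVal_cons, wordVal_cons, Letter.val_not, wordVal_nil]
        simp [Letter.val])
    (by
      intro W hW
      rcases List.mem_append.1 hW with hW | hW
      · exact h2 W hW
      · obtain ⟨p, -, rfl⟩ := List.mem_map.1 hW
        simp)
    (by rw [List.flatten_append, wordEdges_append, h6, e1, h, add_neg_cancel])
  rw [List.flatten_append, wordBdry_append, h4, e2, List.nil_append] at hk hk'
  refine ⟨k, ?_, hk'⟩
  rw [← h5]
  have e4 : BB.length = B.length := by simp [hBB]
  simp only [List.length_append, h3, e3, e4, List.length_map] at hk
  omega

end Bar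

/-! ### Duality between fillings and quasimorphisms -/

section Duality

/-- Duality for the filling norm: an element on which all functionals of norm at most one are
bounded by `C` has fillings of norm close to `C`. -/
lemma exists_filling_of_forall_dual_le {S V : Type*} [AddCommGroup V] [Module ℝ V]
    (D : (S →₀ ℝ) →ₗ[ℝ] V) (c : V) (C : ℝ)
    (h : ∀ φ : V →ₗ[ℝ] ℝ, (∀ s, |φ (D (Finsupp.single s 1))| ≤ 1) → φ c ≤ C)
    {ε : ℝ} (hε : 0 < ε) : ∃ b, D b = c ∧ norm1 b ≤ C + ε := by
  have hC : 0 ≤ C := by simpa using h 0 (by simp)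
  have hrange : c ∈ LinearMap.range D := by
    by_contra hc
    obtain ⟨f, hf, hD⟩ := Submodule.exists_le_ker_of_notMem hc
    -- A functional vanishing on the range satisfies the norm condition at every scale, so it can be
    -- scaled to violate the bound C at c.
    have h1 := h (((C + 1) / f c) • f) fun s => by
      have : f (D (Finsupp.single s 1)) = 0 := hD ⟨_, rfl⟩
      simp [this]
    rw [LinearMap.smul_apply, smul_eq_mul, div_mul_cancel₀ _ hf] at h1
    linarith
  obtain ⟨b₀, rfl⟩ := hrange
  rcases eq_or_ne b₀ 0 with rfl | hb₀
  · exact ⟨0, by simp, by simpa using by linarith⟩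
  -- The quotient seminorm modulo cycles. The Hahn–Banach extension g of t b₀ ↦ t N(b₀) is dominated
  -- by N, hence vanishes on the kernel of D and factors through D.
  let N : (S →₀ ℝ) → ℝ := fun b => ⨅ z : LinearMap.ker D, norm1 (b + (z : S →₀ ℝ))
  have hbdd (b : S →₀ ℝ) : BddBelow (Set.range fun z : LinearMap.ker D => norm1 (b + (z : S →₀ ℝ))) :=
    ⟨0, by rintro _ ⟨z, rfl⟩; exact norm1_nonneg _⟩
  have N_le (b : S →₀ ℝ) (z : LinearMap.ker D) : N b ≤ norm1 (b + (z : S →₀ ℝ)) :=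
    ciInf_le (hbdd b) z
  have N_nonneg (b : S →₀ ℝ) : 0 ≤ N b := le_ciInf fun z => norm1_nonneg _
  have N_hom' (t : ℝ) (ht : 0 < t) (x : S →₀ ℝ) : N (t • x) ≤ t * N x := by
    rw [Real.mul_iInf_of_nonneg ht.le]
    refine le_ciInf fun z => ?_
    have := N_le (t • x) (t • z)
    rwa [Submodule.coe_smul, ← smul_add, norm1_smul, abs_of_pos ht] at this
  have N_hom (t : ℝ) (ht : 0 < t) (x : S →₀ ℝ) : N (t • x) = t * N x := by
    refine (N_hom' t ht x).antisymm ?_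
    have := N_hom' t⁻¹ (inv_pos.2 ht) (t • x)
    rw [inv_smul_smul₀ ht.ne'] at this
    calc t * N x ≤ t * (t⁻¹ * N (t • x)) := by gcongr
      _ = N (t • x) := by field_simp
  have N_add (x y : S →₀ ℝ) : N (x + y) ≤ N x + N y := by
    refine le_ciInf_add_ciInf fun z w => ?_
    refine (N_le (x + y) (z + w)).trans ?_
    rw [Submodule.coe_add, add_add_add_comm]
    exact norm1_add_le _ _
  obtain ⟨g, hg, hgN⟩ := exists_extension_of_le_sublinear
    (LinearPMap.mkSpanSingleton b₀ (N b₀) hb₀) N N_hom N_add (by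
      rintro ⟨x, hx⟩
      obtain ⟨t, rfl⟩ := Submodule.mem_span_singleton.1 hx
      have happ : LinearPMap.mkSpanSingleton b₀ (N b₀) hb₀ ⟨t • b₀, hx⟩ = t * N b₀ :=
        LinearPMap.mkSpanSingleton'_apply _ _ _ _ _
      rw [happ]
      rcases le_or_gt t 0 with ht | ht
      · exact (mul_nonpos_of_nonpos_of_nonneg ht (N_nonneg _)).trans (N_nonneg _)
      · exact (N_hom t ht b₀).ge)
  have hgb : g b₀ = N b₀ := by
    have := hg ⟨b₀, Submodule.mem_span_singleton_self b₀⟩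
    rw [this, LinearPMap.mkSpanSingleton_apply]
  have hker : LinearMap.ker D ≤ LinearMap.ker g := by
    have hle (z : S →₀ ℝ) (hz : z ∈ LinearMap.ker D) : g z ≤ 0 := by
      refine (hgN z).trans ((N_le z (-⟨z, hz⟩)).trans ?_)
      simp
    intro z hz
    refine LinearMap.mem_ker.2 (le_antisymm (hle z hz) ?_)
    have := hle (-z) (neg_mem hz)
    rw [map_neg] at this
    linarith
  obtain ⟨φ, hφ⟩ : ∃ φ : V →ₗ[ℝ] ℝ, φ ∘ₗ D = g := by
    have : g ∈ LinearMap.range D.dualMap := by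
      rw [LinearMap.range_dualMap_eq_dualAnnihilator_ker, Submodule.mem_dualAnnihilator]
      exact fun w hw => hker hw
    obtain ⟨φ, hφ⟩ := this
    exact ⟨φ, hφ⟩
  have hφ' (b : S →₀ ℝ) : φ (D b) = g b := LinearMap.congr_fun hφ b
  have h1 := h φ fun s => by
    have hle (r : ℝ) : g (Finsupp.single s r) ≤ |r| :=
      (hgN _).trans ((N_le _ 0).trans (by simp))
    rw [hφ', abs_le]
    refine ⟨?_, by simpa using hle 1⟩
    have := hle (-1)
    rw [Finsupp.single_neg, map_neg, abs_neg, abs_one] at this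
    linarith
  rw [hφ', hgb] at h1
  obtain ⟨z, hz⟩ := exists_lt_of_ciInf_lt (show N b₀ < C + ε by linarith)
  exact ⟨b₀ + z, by simp, hz.le⟩

/-- The inclusion `ℚ → ℝ` has `ℚ`-linear retractions that are arbitrarily close to the identity on
a given finite set. -/
lemma exists_rat_linearMap_near (s : Finset ℝ) {ε : ℝ} (hε : 0 < ε) :
    ∃ f : ℝ →ₗ[ℚ] ℚ, f 1 = 1 ∧ ∀ x ∈ s, |(f x : ℝ) - x| ≤ ε := by
  classical
  obtain ⟨p, hp⟩ := (Algebra.linearMap ℚ ℝ).exists_leftInverse_of_injective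
    (LinearMap.ker_eq_bot.2 (algebraMap ℚ ℝ).injective)
  have hp1 : p 1 = 1 := by
    have := LinearMap.congr_fun hp 1
    simpa using this
  -- The error of an arbitrary retraction p. It vanishes at 1 and takes the finite set into a
  -- finite-dimensional ℚ-space W, so p is corrected by a ℚ-linear map sending a basis of W to
  -- nearby rationals.
  set w : ℝ →ₗ[ℚ] ℝ := LinearMap.id - (Algebra.linearMap ℚ ℝ) ∘ₗ p with hw
  have hwx (x : ℝ) : w x = x - p x := by simp [hw]
  set W : Submodule ℚ ℝ := Submodule.span ℚ (s.image w) with hW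
  have : Module.Finite ℚ W := Module.Finite.span_of_finite ℚ (Finset.finite_toSet _)
  set B := Module.finBasis ℚ W
  obtain ⟨P, hP⟩ := W.subtype.exists_leftInverse_of_injective W.ker_subtype
  set M : ℝ := ∑ x ∈ s, ∑ j, |((B.repr (P (w x)) j : ℚ) : ℝ)| with hM
  have hM0 : 0 ≤ M := Finset.sum_nonneg fun _ _ => Finset.sum_nonneg fun _ _ => abs_nonneg _
  set δ := ε / (M + 1) with hδ
  have hδ0 : 0 < δ := by positivity
  choose r hr using fun j => exists_rat_near ((B j : W) : ℝ) hδ0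
  refine ⟨p + (B.constr ℚ r) ∘ₗ P ∘ₗ w, by simp [hp1, hwx], fun x hx => ?_⟩
  have hxW : w x ∈ W := Submodule.subset_span (by
    rw [Finset.coe_image]; exact Set.mem_image_of_mem _ hx)
  have hPx : ((P (w x) : W) : ℝ) = w x := by
    have := LinearMap.congr_fun hP ⟨w x, hxW⟩
    exact congrArg Subtype.val this
  have h1 : (w x : ℝ) = ∑ j, ((B.repr (P (w x)) j : ℚ) : ℝ) * ((B j : W) : ℝ) := by
    have := congrArg Subtype.val (B.sum_repr (P (w x)))
    rw [hPx] at this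
    refine this.symm.trans ?_
    rw [Submodule.coe_sum]
    exact Finset.sum_congr rfl fun j _ => by rw [Submodule.coe_smul, Rat.smul_def]
  have h2 : (((p + (B.constr ℚ r) ∘ₗ P ∘ₗ w) x : ℚ) : ℝ) - x =
      ∑ j, ((B.repr (P (w x)) j : ℚ) : ℝ) * (r j - ((B j : W) : ℝ)) := by
    simp only [mul_sub, Finset.sum_sub_distrib]
    rw [← h1]
    simp only [LinearMap.add_apply, LinearMap.comp_apply, Module.Basis.constr_apply_fintype,
      Module.Basis.equivFun_apply, smul_eq_mul]
    push_cast
    linarith [hwx x]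
  rw [h2]
  have h3 : ∑ j, |((B.repr (P (w x)) j : ℚ) : ℝ)| ≤ M :=
    Finset.single_le_sum (f := fun x => ∑ j, |((B.repr (P (w x)) j : ℚ) : ℝ)|)
      (fun _ _ => Finset.sum_nonneg fun _ _ => abs_nonneg _) hx
  calc |∑ j, ((B.repr (P (w x)) j : ℚ) : ℝ) * (r j - ((B j : W) : ℝ))|
      ≤ ∑ j, |((B.repr (P (w x)) j : ℚ) : ℝ)| * δ := by
        refine (Finset.abs_sum_le_sum_abs _ _).trans (Finset.sum_le_sum fun j _ => ?_)
        rw [abs_mul]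
        gcongr
        rw [abs_sub_comm]
        exact (hr j).le
    _ ≤ M * δ := by rw [← Finset.sum_mul]; gcongr
    _ ≤ ε := by
      rw [hδ, mul_div_assoc', div_le_iff₀ (by positivity)]
      nlinarith

end Duality

/-! ### Homogenization and averaging of quasimorphisms on ℤ. -/

section Quasimorphism

/-- An odd quasimorphism on `ℤ` of defect at most one is at distance at most one from a
homomorphism. -/
lemma exists_homogenization (f : ℤ → ℝ) (hodd : ∀ n, f (-n) = -f n)
    (hf : ∀ m n, |f m + f n - f (m + n)| ≤ 1) : ∃ h : ℝ, ∀ n : ℤ, |f n - n * h| ≤ 1 := by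
  -- Both f + 1 and 1 - f are subadditive. Their Fekete limits are opposite and are lower bounds for
  -- the quotients, which gives the two one-sided estimates with constant exactly 1.
  have hsub : Subadditive fun n : ℕ => f n + 1 := fun m n => by
    have := (abs_le.1 (hf m n)).1
    push_cast
    linarith
  have hsub' : Subadditive fun n : ℕ => 1 - f n := fun m n => by
    have := (abs_le.1 (hf m n)).2
    push_cast
    linarith
  have hlin (n : ℕ) : |f n| ≤ n * (|f 1| + 1) := by
    induction n with
    | zero =>
      have := hodd 0
      simp only [neg_zero] at this
      have h0 : f 0 = 0 := by linarith
      simp [h0]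
    | succ n ih =>
      have h1 := abs_le.1 (hf n 1)
      have h2 := abs_le.1 ih
      have h3 := neg_abs_le (f 1)
      have h4 := le_abs_self (f 1)
      push_cast
      rw [abs_le]
      constructor <;> nlinarith
  have hb : BddBelow (Set.range fun n : ℕ => (f n + 1) / n) := by
    refine ⟨-(|f 1| + 1), ?_⟩
    rintro _ ⟨n, rfl⟩
    rcases Nat.eq_zero_or_pos n with rfl | hn
    · simpa using by linarith [abs_nonneg (f 1)]
    · have : (0 : ℝ) < n := by exact_mod_cast hn
      have h2 := (abs_le.1 (hlin n)).1
      simp only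
      rw [le_div_iff₀ this]
      linarith
  have hb' : BddBelow (Set.range fun n : ℕ => (1 - f n) / n) := by
    refine ⟨-(|f 1| + 1), ?_⟩
    rintro _ ⟨n, rfl⟩
    rcases Nat.eq_zero_or_pos n with rfl | hn
    · simpa using by linarith [abs_nonneg (f 1)]
    · have : (0 : ℝ) < n := by exact_mod_cast hn
      have h2 := (abs_le.1 (hlin n)).2
      simp only
      rw [le_div_iff₀ this]
      linarith
  have hlim := hsub.tendsto_lim hb
  have hlim' := hsub'.tendsto_lim hb'
  have hsum : hsub'.lim = -hsub.lim := by
    have h1 := (hlim.add hlim')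
    have h2 : Filter.Tendsto (fun n : ℕ => (f n + 1) / n + (1 - f n) / n) Filter.atTop (nhds 0) := by
      refine (tendsto_const_div_atTop_nhds_zero_nat 2).congr fun n => ?_
      rw [← add_div]
      congr 1
      ring
    linarith [tendsto_nhds_unique h1 h2]
  have hpos (n : ℕ) : |f n - n * hsub.lim| ≤ 1 := by
    rcases Nat.eq_zero_or_pos n with rfl | hn
    · have := hlin 0
      simp only [Nat.cast_zero, zero_mul] at this ⊢
      simpa using this.trans zero_le_one
    · have hn' : (0 : ℝ) < n := by exact_mod_cast hn
      have h1 := hsub.lim_le_div hb hn.ne'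
      have h2 := hsub'.lim_le_div hb' hn.ne'
      rw [le_div_iff₀ hn'] at h1 h2
      rw [hsum] at h2
      rw [abs_le]
      constructor <;> linarith
  refine ⟨hsub.lim, fun n => ?_⟩
  obtain ⟨m, rfl | rfl⟩ := n.eq_nat_or_neg
  · exact_mod_cast hpos m
  · rw [hodd, ← abs_neg]
    convert hpos m using 2
    push_cast
    ring

/-- The average of an odd function `f` at distance at most one from `n ↦ n h` over a large square
with center `k` is close to `k h`. -/
lemma abs_average_sub_le (f : ℤ → ℝ) (hodd : ∀ n, f (-n) = -f n) {h : ℝ}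
    (hf : ∀ n : ℤ, |f n - n * h| ≤ 1) (k : ℤ) {K : ℕ} (hK : K ≠ 0) :
    |(∑ s ∈ Finset.range K, ∑ t ∈ Finset.range K, f (s + k - t)) / (K : ℝ) ^ 2 - k * h| ≤
      2 * |(k : ℝ)| / K := by
  set β : ℤ → ℝ := fun n => f n - n * h with hβ
  have hβodd (n : ℤ) : β (-n) = -β n := by simp only [hβ, hodd]; push_cast; ring
  -- Shifting k by one telescopes in s, so each t contributes only two end terms. At k = 0 the
  -- double sum vanishes because β is odd and exchanging s and t changes its sign.
  have hshift (k : ℤ) : |(∑ t ∈ Finset.range K, ∑ s ∈ Finset.range K, β (s + (k + 1) - t)) -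
      ∑ t ∈ Finset.range K, ∑ s ∈ Finset.range K, β (s + k - t)| ≤ 2 * K := by
    rw [← Finset.sum_sub_distrib]
    refine (Finset.abs_sum_le_sum_abs _ _).trans ?_
    have : ∀ t ∈ Finset.range K, |(∑ s ∈ Finset.range K, β (s + (k + 1) - t)) -
        ∑ s ∈ Finset.range K, β (s + k - t)| ≤ 2 := fun t _ => by
      have h1 := Finset.sum_range_sub (fun s : ℕ => β (s + k - t)) K
      rw [Finset.sum_sub_distrib] at h1
      have h2 : ∀ s : ℕ, (s : ℤ) + (k + 1) - t = ((s + 1 : ℕ) : ℤ) + k - t := fun s => by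
        push_cast; ring
      simp only [h2, h1]
      have := abs_sub (β ((K : ℤ) + k - t)) (β (((0 : ℕ) : ℤ) + k - t))
      linarith [hf ((K : ℤ) + k - t), hf (((0 : ℕ) : ℤ) + k - t)]
    refine (Finset.sum_le_sum this).trans ?_
    simp [mul_comm]
  have hzero : ∑ t ∈ Finset.range K, ∑ s ∈ Finset.range K, β (s + 0 - t) = 0 := by
    have h1 : ∑ t ∈ Finset.range K, ∑ s ∈ Finset.range K, β (s + 0 - t) =
        -∑ t ∈ Finset.range K, ∑ s ∈ Finset.range K, β (s + 0 - t) := by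
      conv_lhs => rw [Finset.sum_comm]
      rw [← Finset.sum_neg_distrib]
      refine Finset.sum_congr rfl fun s _ => ?_
      rw [← Finset.sum_neg_distrib]
      refine Finset.sum_congr rfl fun t _ => ?_
      rw [← hβodd]
      congr 1
      ring
    linarith
  have hall (k : ℤ) : |∑ t ∈ Finset.range K, ∑ s ∈ Finset.range K, β (s + k - t)| ≤
      2 * K * |(k : ℝ)| := by
    have hnat (n : ℕ) : |∑ t ∈ Finset.range K, ∑ s ∈ Finset.range K, β (s + n - t)| ≤
        2 * K * n := by
      induction n with
      | zero => simpa using hzero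
      | succ n ih =>
        have h1 := abs_le.1 (hshift n)
        have h2 := abs_le.1 ih
        push_cast
        rw [abs_le]
        constructor <;> linarith
    obtain ⟨m, rfl | rfl⟩ := k.eq_nat_or_neg
    · simpa using hnat m
    · have h1 : ∑ t ∈ Finset.range K, ∑ s ∈ Finset.range K, β (s + -(m : ℤ) - t) =
          -∑ t ∈ Finset.range K, ∑ s ∈ Finset.range K, β (s + m - t) := by
        conv_lhs => rw [Finset.sum_comm]
        rw [← Finset.sum_neg_distrib]
        refine Finset.sum_congr rfl fun s _ => ?_
        rw [← Finset.sum_neg_distrib]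
        refine Finset.sum_congr rfl fun t _ => ?_
        rw [← hβodd]
        congr 1
        ring
      rw [h1, abs_neg]
      simpa using hnat m
  have hK' : (0 : ℝ) < K := by exact_mod_cast Nat.pos_of_ne_zero hK
  have hexp : ∑ s ∈ Finset.range K, ∑ t ∈ Finset.range K, f (s + k - t) =
      (∑ t ∈ Finset.range K, ∑ s ∈ Finset.range K, β (s + k - t)) + (K : ℝ) ^ 2 * (k * h) := by
    have h1 : ∑ t ∈ Finset.range K, ∑ s ∈ Finset.range K, ((s : ℝ) - t) * h = 0 := by
      have : ∑ t ∈ Finset.range K, ∑ s ∈ Finset.range K, ((s : ℝ) - t) = 0 := by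
        simp [Finset.sum_sub_distrib, ← Finset.mul_sum]
      simp only [← Finset.sum_mul, this, zero_mul]
    rw [Finset.sum_comm]
    have h2 : ∀ s t : ℕ, f (s + k - t) = β (s + k - t) + ((s : ℝ) - t) * h + k * h := by
      intro s t
      simp only [hβ]
      push_cast
      ring
    simp only [h2, Finset.sum_add_distrib, h1]
    simp
    ring
  rw [hexp, add_div, mul_div_cancel_left₀ _ (by positivity), add_sub_cancel_right, abs_div,
    abs_of_pos (by positivity : (0 : ℝ) < (K : ℝ) ^ 2), div_le_div_iff₀ (by positivity) hK']
  have := hall k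
  nlinarith

end Quasimorphism

/-! ### From bounds on quasimorphisms to bounds on stable commutator length. -/

section UpperBound

variable {G : Type*} [Group G]

lemma exists_int_multiple {S : Type*} (b : S →₀ ℚ) :
    ∃ D : ℕ, 0 < D ∧ ∃ z : S →₀ ℤ, z.mapRange (Int.cast : ℤ → ℚ) Int.cast_zero = (D : ℚ) • b := by
  classical
  induction b using Finsupp.induction_linear with
  | zero => exact ⟨1, one_pos, 0, by simp⟩
  | add a b ha hb =>
    obtain ⟨D, hD, y, hy⟩ := ha
    obtain ⟨E, hE, z, hz⟩ := hb
    refine ⟨D * E, Nat.mul_pos hD hE, (E : ℤ) • y + (D : ℤ) • z, ?_⟩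
    ext s
    have h1 := DFunLike.congr_fun hy s
    have h2 := DFunLike.congr_fun hz s
    simp only [Finsupp.mapRange_apply, Finsupp.smul_apply, smul_eq_mul, Finsupp.add_apply] at h1 h2 ⊢
    push_cast
    rw [h1, h2]
    ring
  | single s r =>
    refine ⟨r.den, r.den_pos, Finsupp.single s r.num, ?_⟩
    rw [Finsupp.mapRange_single, Finsupp.smul_single, smul_eq_mul, Rat.den_mul_eq_num]

/-- A real filling of a rational chain can be replaced by a rational one, with arbitrarily small
increase of the norm. -/
lemma exists_rat_filling (b : G × G →₀ ℝ) (c : G →₀ ℚ)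
    (h : barBd G ℝ b = c.mapRange (Rat.cast : ℚ → ℝ) Rat.cast_zero) {ε : ℝ} (hε : 0 < ε) :
    ∃ b' : G × G →₀ ℚ, barBd G ℚ b' = c ∧ ((norm1 b' : ℚ) : ℝ) ≤ norm1 b + ε := by
  classical
  obtain ⟨f, hf1, hf⟩ := exists_rat_linearMap_near (b.support.image b)
    (ε := ε / (b.support.card + 1)) (by positivity)
  have hfq (q : ℚ) : f q = q := by
    have := f.map_smul q 1
    rwa [hf1, Rat.smul_one_eq_cast, smul_eq_mul, mul_one] at this
  refine ⟨Finsupp.mapRange.linearMap f b, ?_, ?_⟩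
  · have h1 : barBd G ℚ (Finsupp.mapRange.linearMap f b) =
        Finsupp.mapRange.linearMap f (barBd G ℝ b) := by
      clear h hf
      induction b using Finsupp.induction_linear with
      | zero => simp
      | add a b ha hb => simp only [map_add, ha, hb]
      | single p r =>
        obtain ⟨x, y⟩ := p
        simp only [Finsupp.mapRange.linearMap_apply, Finsupp.mapRange_single, barBd_single,
          smul_sub, smul_add, Finsupp.smul_single, smul_eq_mul, mul_one]
        rw [← Finsupp.mapRange.linearMap_apply, map_sub, map_add]
        simp
    rw [h1, h]
    ext g
    simp [hfq]
  · have hs : (Finsupp.mapRange.linearMap f b).support ⊆ b.support :=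
      Finsupp.support_mapRange (hf := map_zero f)
    rw [norm1_eq_sum _ hs, norm1_eq_sum b subset_rfl]
    push_cast
    calc ∑ s ∈ b.support, |((Finsupp.mapRange.linearMap f b s : ℚ) : ℝ)|
        ≤ ∑ s ∈ b.support, (|b s| + ε / (b.support.card + 1)) := by
          refine Finset.sum_le_sum fun s hs => ?_
          have h1 := hf (b s) (Finset.mem_image_of_mem _ hs)
          have h2 := abs_sub_abs_le_abs_sub ((f (b s) : ℚ) : ℝ) (b s)
          simp only [Finsupp.mapRange.linearMap_apply, Finsupp.mapRange_apply]
          linarith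
      _ ≤ _ := by
          rw [Finset.sum_add_distrib, Finset.sum_const, nsmul_eq_mul]
          gcongr
          rw [mul_div_assoc', div_le_iff₀ (by positivity)]
          nlinarith

lemma SumCommProd.merge_replicate {k n : ℕ} {g : G} {L : List G}
    (h : SumCommProd k (List.replicate n g ++ L)) : SumCommProd (k + n) (g ^ n :: L) := by
  induction n generalizing L with
  | zero => simpa using SumCommProd.cons_one h
  | succ n ih =>
    have h1 : SumCommProd k (List.replicate n g ++ g :: L) := by
      refine h.perm ?_
      rw [List.replicate_succ]
      exact List.perm_middle.symm
    have := (ih h1).merge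
    rwa [← pow_succ] at this

/-- The cost is counted by copies. When the v i are themselves N-th powers, it is negligible against
the resulting exponent n N. -/
lemma SumCommProd.merge_flatMap_replicate {ι : Type*} {k n : ℕ} (v : ι → G) (l : List ι)
    {L : List G} (h : SumCommProd k ((l.flatMap fun i => List.replicate n (v i)) ++ L)) :
    SumCommProd (k + n * l.length) ((l.map fun i => v i ^ n) ++ L) := by
  induction l generalizing k L with
  | nil => simpa using h
  | cons i l ih =>
    rw [List.flatMap_cons, List.append_assoc] at h
    have h1 := ih (h.merge_replicate.perm (List.perm_middle (l₁ := l.flatMap _)).symm)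
    rw [List.map_cons, List.length_cons]
    refine SumCommProd.mono (h1.perm List.perm_middle) (le_of_eq ?_)
    ring

variable {ι : Type*} [Fintype ι]

/-- If the homogenizations of all odd quasimorphisms of defect at most one are bounded by `A` on the
chain `∑ uᵢ`, then so are its fillings, asymptotically. -/
lemma exists_filling_of_forall_quasimorphism_le (u : ι → G) {A : ℝ}
    (H : ∀ (ψ : G → ℝ) (h : ι → ℝ), (∀ g, ψ g⁻¹ = -ψ g) →
      (∀ x y, |ψ x + ψ y - ψ (x * y)| ≤ 1) → (∀ i (n : ℤ), |ψ (u i ^ n) - n * h i| ≤ 1) →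
      ∑ i, h i ≤ A) (N : ℕ) :
    ∃ b : G × G →₀ ℚ, barBd G ℚ b = ∑ i, (1 / 2 : ℚ) •
        (Finsupp.single (u i ^ N) 1 - Finsupp.single (u i ^ N)⁻¹ 1) ∧
      ((norm1 b : ℚ) : ℝ) ≤ N * A + Fintype.card ι + 2 := by
  obtain ⟨b, hb, hn⟩ := exists_filling_of_forall_dual_le (barBd G ℝ)
    (∑ i, (1 / 2 : ℝ) • (Finsupp.single (u i ^ N) 1 - Finsupp.single (u i ^ N)⁻¹ 1))
    (N * A + Fintype.card ι) (ε := 1) (by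
      intro φ hφ
      -- Antisymmetrization makes ψ odd, and the chain is antisymmetrized to match. The defect of ψ
      -- is the mean of the values of φ on the boundaries of (x, y) and of (y⁻¹, x⁻¹), up to sign,
      -- hence still at most one.
      set ψ : G → ℝ := fun g => (φ (Finsupp.single g 1) - φ (Finsupp.single g⁻¹ 1)) / 2 with hψ
      have hodd (g : G) : ψ g⁻¹ = -ψ g := by simp only [hψ, inv_inv]; ring
      have hdef (x y : G) : |ψ x + ψ y - ψ (x * y)| ≤ 1 := by
        have h1 := abs_le.1 (hφ (x, y))
        have h2 := abs_le.1 (hφ (y⁻¹, x⁻¹))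
        simp only [barBd_single, one_smul, map_add, map_sub] at h1 h2
        simp only [hψ, mul_inv_rev]
        rw [abs_le]
        constructor <;> linarith
      have hhom (i : ι) := exists_homogenization (fun n => ψ (u i ^ n))
        (fun n => by simp only [zpow_neg, hodd]) (fun m n => by
          simp only [zpow_add]; exact hdef _ _)
      choose h hh using hhom
      have h1 := H ψ h hodd hdef hh
      have h2 : φ (∑ i, (1 / 2 : ℝ) • (Finsupp.single (u i ^ N) 1 -
          Finsupp.single (u i ^ N)⁻¹ 1)) = ∑ i, ψ (u i ^ N) := by
        rw [map_sum]
        refine Finset.sum_congr rfl fun i _ => ?_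
        rw [map_smul, map_sub, smul_eq_mul]
        simp only [hψ]
        ring
      rw [h2]
      calc ∑ i, ψ (u i ^ N) ≤ ∑ i, (N * h i + 1) := Finset.sum_le_sum fun i _ => by
            have := (abs_le.1 (hh i N)).2
            simp only [zpow_natCast, Int.cast_natCast] at this
            linarith
        _ = N * ∑ i, h i + Fintype.card ι := by
            rw [Finset.sum_add_distrib, Finset.mul_sum]; simp
        _ ≤ _ := by gcongr) one_pos
  obtain ⟨b', hb', hn'⟩ := exists_rat_filling b (∑ i, (1 / 2 : ℚ) •
    (Finsupp.single (u i ^ N) 1 - Finsupp.single (u i ^ N)⁻¹ 1)) (by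
      classical
      rw [hb]
      ext g
      simp only [Finsupp.mapRange_apply, Finsupp.finsetSum_apply, Finsupp.smul_apply,
        Finsupp.sub_apply, smul_eq_mul, Rat.cast_sum, Rat.cast_mul, Rat.cast_sub,
        Finsupp.single_apply, Rat.cast_div, Rat.cast_one, Rat.cast_ofNat]
      simp only [apply_ite (Rat.cast : ℚ → ℝ), Rat.cast_one, Rat.cast_zero]) one_pos
  exact ⟨b', hb', by linarith⟩

/-- Commutator lengths of powers are bounded by rational fillings. -/
lemma commLengthSum_le_of_barBd_eq (u : ι → G) (N : ℕ) (b : G × G →₀ ℚ)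
    (hb : barBd G ℚ b = ∑ i, (1 / 2 : ℚ) •
        (Finsupp.single (u i ^ N) 1 - Finsupp.single (u i ^ N)⁻¹ 1)) :
    ∃ D k : ℕ, 0 < D ∧
      SumCommProd k ((((Finset.univ : Finset ι).toList.map u)).map (· ^ (2 * D * N))) ∧
      4 * (k : ℚ) ≤ 2 * D * (norm1 b + 6 * Fintype.card ι) := by
  classical
  obtain ⟨D, hD, z, hz⟩ := exists_int_multiple b
  set l := (Finset.univ : Finset ι).toList with hl
  -- An edge u^(-N) with negative sign has value u^N, so the boundary consists of 2D copies of u^N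
  -- for each i. The filling is 2z because the coefficients in b's boundary are halves.
  set B : List (G × Bool) := l.flatMap fun i =>
    List.replicate D (u i ^ N, true) ++ List.replicate D ((u i ^ N)⁻¹, false) with hB
  have hBlen : B.length = 2 * D * Fintype.card ι := by
    have : l.length = Fintype.card ι := by simp [hl]
    simp only [hB, List.length_flatMap, List.length_append, List.length_replicate,
      List.map_const', List.sum_replicate, this, smul_eq_mul]
    ring
  have hBval : (B.map fun p => Letter.val (.inl p)) =
      (l.flatMap fun i => List.replicate (2 * D) (u i ^ N)) ++ [] := by
    rw [hB, List.map_flatMap, List.append_nil]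
    congr 1
    funext i
    simp only [List.map_append, List.map_replicate, Letter.val, inv_inv]
    rw [← List.replicate_add, two_mul]
  have hrep (p : G × Bool) (n : ℕ) :
      wordEdges ((List.replicate n p).map Sum.inl) = n • Letter.edge (.inl p) := by
    rw [wordEdges, List.map_replicate, List.map_replicate, List.sum_replicate]
  have hBedge : wordEdges (B.map Sum.inl) = D • ∑ i,
      (Finsupp.single (u i ^ N) (1 : ℤ) - Finsupp.single (u i ^ N)⁻¹ 1) := by
    rw [hB, ← Finset.sum_map_toList, ← hl]
    clear_value l
    clear hBval hBlen hl hB B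
    induction l with
    | nil => simp
    | cons i l ih =>
      rw [List.flatMap_cons, List.map_append, wordEdges_append, ih, List.map_append,
        wordEdges_append, hrep, hrep, List.map_cons, List.sum_cons, smul_add]
      simp only [Letter.edge, smul_sub, smul_neg]
      abel
  have hcast : Function.Injective
      (Finsupp.mapRange (Int.cast : ℤ → ℚ) Int.cast_zero : (G →₀ ℤ) → (G →₀ ℚ)) :=
    Finsupp.mapRange_injective _ _ Int.cast_injective
  have hbdcast (y : G × G →₀ ℤ) : barBd G ℚ (y.mapRange (Int.cast : ℤ → ℚ) Int.cast_zero) =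
      (barBd G ℤ y).mapRange (Int.cast : ℤ → ℚ) Int.cast_zero := by
    have hadd {S : Type _} (a b : S →₀ ℤ) :
        (a + b).mapRange (Int.cast : ℤ → ℚ) Int.cast_zero =
          a.mapRange (Int.cast : ℤ → ℚ) Int.cast_zero +
          b.mapRange (Int.cast : ℤ → ℚ) Int.cast_zero :=
      Finsupp.mapRange_add (by simp) _ _
    induction y using Finsupp.induction_linear with
    | zero => simp
    | add a b ha hb => rw [hadd, map_add, map_add, hadd, ha, hb]
    | single p r =>
      obtain ⟨x, y⟩ := p
      ext g
      simp [barBd_single, Finsupp.single_apply, apply_ite (Int.cast : ℤ → ℚ)]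
  have hmain : barBd G ℤ ((2 : ℤ) • z) = wordEdges (B.map Sum.inl) := by
    apply hcast
    rw [← hbdcast, hBedge]
    have h1 : ((2 : ℤ) • z).mapRange (Int.cast : ℤ → ℚ) Int.cast_zero = (2 * D : ℚ) • b := by
      rw [mul_smul, ← hz]
      ext s
      simp
    rw [h1, map_smul, hb]
    ext g
    simp only [Finsupp.mapRange_apply, Finsupp.finsetSum_apply, Finsupp.smul_apply,
      Finsupp.sub_apply, smul_eq_mul, nsmul_eq_mul, Int.cast_mul, Int.cast_sum, Int.cast_sub,
      Finsupp.single_apply, apply_ite (Int.cast : ℤ → ℚ), Int.cast_one, Int.cast_zero,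
      Int.cast_natCast, Finset.mul_sum]
    refine Finset.sum_congr rfl fun i _ => ?_
    ring
  obtain ⟨k, hk, hk'⟩ := SumCommProd.of_barBd_eq _ B hmain
  rw [hBval] at hk'
  have h2 := hk'.merge_flatMap_replicate
  -- Per index, the gluing bound contributes 4D and merging 2D copies contributes 4·2D; together
  -- these make the term 2D·6.
  refine ⟨D, k + 2 * D * l.length, hD, ?_, ?_⟩
  · rw [List.append_nil] at h2
    rw [List.map_map]
    convert h2 using 2
    funext i
    simp only [Function.comp_apply]
    rw [← pow_mul, mul_comm]
  · have h3 : ((norm1 z : ℤ) : ℚ) = D * norm1 b := by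
      have h4 : norm1 ((D : ℚ) • b) = D * norm1 b := by rw [norm1_smul, Nat.abs_cast]
      rw [← h4, ← hz, norm1_eq_sum (z.mapRange _ _) Finsupp.support_mapRange,
        norm1_eq_sum z subset_rfl]
      simp
    rw [norm1_smul, hBlen] at hk
    have h5 : l.length = Fintype.card ι := by simp [hl]
    have h6 : (4 * (k : ℤ) : ℚ) ≤ ((2 * norm1 z + 2 * (2 * D * Fintype.card ι : ℕ) : ℤ) : ℚ) := by
      exact_mod_cast hk
    push_cast at h6 ⊢
    rw [h3] at h6
    rw [h5]
    nlinarith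

/-- If the homogenizations of all odd quasimorphisms of defect at most one are bounded by `A` on the
chain `∑ uᵢ`, then its stable commutator length is at most `A / 4`. -/
lemma sclSum_le_of_forall_quasimorphism_le (u : ι → G) {A : ℝ} (hA : 0 ≤ A)
    (H : ∀ (ψ : G → ℝ) (h : ι → ℝ), (∀ g, ψ g⁻¹ = -ψ g) →
      (∀ x y, |ψ x + ψ y - ψ (x * y)| ≤ 1) → (∀ i (n : ℤ), |ψ (u i ^ n) - n * h i| ≤ 1) →
      ∑ i, h i ≤ A) :
    sclSum ((Finset.univ : Finset ι).toList.map u) ≤ ENNReal.ofReal (A / 4) := by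
  refine ENNReal.le_of_forall_pos_le_add fun ε hε _ => ?_
  -- The denominator D is uncontrolled, so the estimate is obtained only for exponents 2DN; these
  -- are arbitrarily large, which suffices for the lower limit.
  refine Filter.liminf_le_of_frequently_le ?_ (by isBoundedDefault)
  rw [Filter.frequently_atTop]
  intro a
  -- The filling contributes |ι| + 2 and the gluing and merging 6|ι|; N is taken so large that C/N ≤
  -- ε.
  set C : ℝ := (7 * Fintype.card ι + 2) / 4 with hC
  obtain ⟨N₀, hN₀⟩ := exists_nat_ge (C / ε)
  set N := max (max a N₀) 1 with hN
  have hN1 : 1 ≤ N := le_max_right _ _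
  have hNa : a ≤ N := (le_max_left _ _).trans (le_max_left _ _)
  have hNε : C ≤ ε * N := by
    have : C / ε ≤ N := hN₀.trans (by exact_mod_cast (le_max_right _ _).trans (le_max_left _ _))
    rw [div_le_iff₀ (by exact_mod_cast hε)] at this
    linarith
  obtain ⟨b, hb, hn⟩ := exists_filling_of_forall_quasimorphism_le u H N
  obtain ⟨D, k, hD, hk, hk'⟩ := commLengthSum_le_of_barBd_eq u N b hb
  refine ⟨2 * D * N, ?_, ?_⟩
  · nlinarith
  · have h1 : ((commLengthSum ((((Finset.univ : Finset ι).toList.map u)).map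
        (· ^ (2 * D * N))) : ℕ∞) : ℝ≥0∞) ≤ (k : ℝ≥0∞) := by
      exact_mod_cast ENat.toENNReal_le.2 (commLengthSum_le_iff.2 hk)
    have hk'' : 4 * (k : ℝ) ≤ 2 * D * ((norm1 b : ℚ) + 6 * Fintype.card ι) := by exact_mod_cast hk'
    have hD' : (0 : ℝ) < D := by exact_mod_cast hD
    have hN' : (0 : ℝ) < N := by exact_mod_cast hN1
    have h2 : (k : ℝ) / ((2 * D * N : ℕ) : ℝ) ≤ A / 4 + ε := by
      rw [div_le_iff₀ (by positivity)]
      push_cast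
      have : 4 * (k : ℝ) ≤ 2 * D * (N * A + Fintype.card ι + 2 + 6 * Fintype.card ι) :=
        hk''.trans (by gcongr)
      have h3 : 2 * (D : ℝ) * C ≤ 2 * D * (ε * N) := by gcongr
      rw [hC] at h3
      nlinarith
    calc _ ≤ (k : ℝ≥0∞) / ((2 * D * N : ℕ) : ℝ≥0∞) := by gcongr
      _ = ENNReal.ofReal ((k : ℝ) / ((2 * D * N : ℕ) : ℝ)) := by
        rw [ENNReal.ofReal_div_of_pos (by positivity), ENNReal.ofReal_natCast,
          ENNReal.ofReal_natCast]
      _ ≤ ENNReal.ofReal (A / 4 + ε) := ENNReal.ofReal_le_ofReal h2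
      _ = _ := by
        rw [ENNReal.ofReal_add (by positivity) (by positivity), ENNReal.ofReal_coe_nnreal]

end UpperBound

/-! ### Paths up to homotopy -/

section Paths

open Path.Homotopic.Quotient (mk_map mk_trans trans_assoc symm_trans trans_symm refl_trans trans_refl)

variable {X : Type*} [TopologicalSpace X]
  {A B : Type*} [TopologicalSpace A] [TopologicalSpace B]
  [SimplyConnectedSpace A] [SimplyConnectedSpace B]

/-- The homotopy class of some path between two points of a path connected space. -/
def somePathCls [PathConnectedSpace X] (x y : X) : Path.Homotopic.Quotient x y :=
  Path.Homotopic.Quotient.mk (PathConnectedSpace.somePath x y)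

/-- The homotopy class of the image under `f` of any path from `a` to `b` in a simply connected
space. -/
def pathCls (f : C(A, X)) (a b : A) : Path.Homotopic.Quotient (f a) (f b) :=
  (somePathCls a b).map f

lemma pathCls_eq_map (f : C(A, X)) {a b : A} (p : Path.Homotopic.Quotient a b) :
    pathCls f a b = p.map f := by
  rw [pathCls, Subsingleton.elim p]

lemma pathCls_trans (f : C(A, X)) (a b c : A) :
    (pathCls f a b).trans (pathCls f b c) = pathCls f a c := by
  rw [pathCls_eq_map f ((somePathCls a b).trans
    (somePathCls b c))]
  simp only [pathCls, somePathCls, ← mk_map, ← mk_trans, Path.map_trans]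

lemma pathCls_comp (f : C(A, X)) (h : C(B, A)) (a b : B) :
    pathCls (f.comp h) a b = pathCls f (h a) (h b) := by
  rw [pathCls_eq_map f ((somePathCls a b).map h)]
  rfl

variable [PathConnectedSpace X] {x₀ : X}

variable (x₀) in
/-- The element of the fundamental group obtained from a homotopy class of paths by joining its
endpoints to the base point. -/
def toLoop {a b : X} (p : Path.Homotopic.Quotient a b) : FundamentalGroup X x₀ :=
  FundamentalGroup.fromPath ((somePathCls x₀ a).trans (p.trans (somePathCls x₀ b).symm))

/-- The order is reversed because a product in `FundamentalGroup` traverses its right factor first.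
-/
lemma toLoop_trans {a b c : X} (p : Path.Homotopic.Quotient a b)
    (q : Path.Homotopic.Quotient b c) : toLoop x₀ (p.trans q) = toLoop x₀ q * toLoop x₀ p := by
  rw [FundamentalGroup.mul_def]
  change (somePathCls x₀ a).trans ((p.trans q).trans (somePathCls x₀ c).symm) =
    ((somePathCls x₀ a).trans (p.trans (somePathCls x₀ b).symm)).trans
      ((somePathCls x₀ b).trans (q.trans (somePathCls x₀ c).symm))
  have h : (somePathCls x₀ b).symm.trans ((somePathCls x₀ b).trans
      (q.trans (somePathCls x₀ c).symm)) = q.trans (somePathCls x₀ c).symm := by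
    rw [← trans_assoc, symm_trans, refl_trans]
  simp only [trans_assoc, h]

lemma toLoop_cast {a b a' b' : X} (p : Path.Homotopic.Quotient a b) (ha : a' = a) (hb : b' = b) :
    toLoop x₀ (p.cast ha hb) = toLoop x₀ p := by
  subst ha hb
  simp

/-- Allows identities in the group to be turned back into path homotopies, and so into singular
triangles. -/
lemma toLoop_injective {a b : X} :
    Function.Injective (toLoop x₀ : Path.Homotopic.Quotient a b → FundamentalGroup X x₀) := by
  have h (p : Path.Homotopic.Quotient a b) :
      (somePathCls x₀ a).symm.trans ((toLoop x₀ p).toPath.trans (somePathCls x₀ b)) = p := by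
    change (somePathCls x₀ a).symm.trans (((somePathCls x₀ a).trans
      (p.trans (somePathCls x₀ b).symm)).trans (somePathCls x₀ b)) = p
    rw [← trans_assoc, ← trans_assoc, symm_trans, refl_trans, trans_assoc, symm_trans, trans_refl]
  intro p q hpq
  rw [← h p, hpq, h q]

lemma toLoop_surjective {a b : X} :
    Function.Surjective (toLoop x₀ : Path.Homotopic.Quotient a b → FundamentalGroup X x₀) := by
  intro g
  refine ⟨(somePathCls x₀ a).symm.trans (g.toPath.trans (somePathCls x₀ b)), ?_⟩
  change (somePathCls x₀ a).trans (((somePathCls x₀ a).symm.trans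
    (g.toPath.trans (somePathCls x₀ b))).trans (somePathCls x₀ b).symm) = g.toPath
  rw [← trans_assoc, ← trans_assoc, trans_symm, refl_trans, trans_assoc, trans_symm, trans_refl]

/-- Only conjugacy is obtained, since the chosen path from the base point to itself may be a
nontrivial loop. -/
lemma isConj_toLoop (g : FundamentalGroup X x₀) : IsConj g (toLoop x₀ g.toPath) := by
  refine isConj_iff.2 ⟨(FundamentalGroup.fromPath (somePathCls x₀ x₀))⁻¹, ?_⟩
  rw [inv_inv, mul_assoc]
  change ((somePathCls x₀ x₀).trans g.toPath).trans (somePathCls x₀ x₀).symm =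
    (somePathCls x₀ x₀).trans (g.toPath.trans (somePathCls x₀ x₀).symm)
  rw [trans_assoc]

variable (x₀) in
/-- The element of the fundamental group given by the image under `f` of a path from `a` to `b` in
a simply connected space. -/
def holonomy (f : C(A, X)) (a b : A) : FundamentalGroup X x₀ := toLoop x₀ (pathCls f a b)

lemma holonomy_mul (f : C(A, X)) (a b c : A) :
    holonomy x₀ f b c * holonomy x₀ f a b = holonomy x₀ f a c := by
  rw [holonomy, holonomy, ← toLoop_trans, pathCls_trans, holonomy]

lemma holonomy_comp (f : C(A, X)) (h : C(B, A)) (a b : B) :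
    holonomy x₀ (f.comp h) a b = holonomy x₀ f (h a) (h b) := by
  rw [holonomy, holonomy, pathCls_comp]

lemma holonomy_self (f : C(A, X)) (a : A) : holonomy x₀ f a a = 1 := by
  exact mul_eq_left.1 (holonomy_mul (x₀ := x₀) f a a a)

end Paths

/-! ### Singular simplices of low dimension -/

section Simplices

open unitInterval

variable {X : Type*} [TopologicalSpace X]

instance contractibleSpace_stdSimplex (n : ℕ) :
    ContractibleSpace (stdSimplex ℝ (Fin (n + 1))) :=
  (convex_stdSimplex ℝ _).contractibleSpace ⟨_, single_mem_stdSimplex ℝ 0⟩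

instance locallyPathConnectedSpace_stdSimplex (n : ℕ) :
    LocallyPathConnectedSpace (stdSimplex ℝ (Fin (n + 1))) :=
  (convex_stdSimplex ℝ _).locallyPathConnectedSpace

/-- The singular simplex given by a path. -/
def pathSimplex {x y : X} (p : Path x y) : SSimplex 1 X :=
  p.toContinuousMap.comp ⟨stdSimplexHomeomorphUnitInterval, Homeomorph.continuous _⟩

lemma pathSimplex_apply {x y : X} (p : Path x y) (v : stdSimplex ℝ (Fin 2)) :
    pathSimplex p v = p (stdSimplexHomeomorphUnitInterval v) := rfl

/-- The collapse of the square onto the triangle: the sides `t = 0` and `t = 1` are collapsed, the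
side `s = 1` is mapped to the edge `02`, and the side `s = 0` to the edges `01` and `12`. -/
def squareToTriangle : C(I × I, stdSimplex ℝ (Fin 3)) where
  toFun z := ⟨![1 - z.2 - (1 - z.1) * min (z.2 : ℝ) (1 - z.2),
      2 * ((1 - z.1) * min (z.2 : ℝ) (1 - z.2)),
      z.2 - (1 - z.1) * min (z.2 : ℝ) (1 - z.2)], by
    obtain ⟨⟨s, hs0, hs1⟩, ⟨t, ht0, ht1⟩⟩ := z
    have h1 : 0 ≤ min t (1 - t) := le_min ht0 (by linarith)
    have h2 : min t (1 - t) ≤ t := min_le_left _ _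
    have h3 : min t (1 - t) ≤ 1 - t := min_le_right _ _
    constructor
    · intro k
      fin_cases k
      · simp; nlinarith
      · simp; exact mul_nonneg (by linarith) h1
      · simp; nlinarith
    · simp [Fin.sum_univ_three]; ring⟩
  continuous_toFun := by
    refine Continuous.subtype_mk (continuous_pi fun k => ?_) _
    fin_cases k <;> simp <;> fun_prop

lemma squareToTriangle_surjective : Function.Surjective squareToTriangle := by
  rintro ⟨v, hv0, hv1⟩
  rw [Fin.sum_univ_three] at hv1
  have h0 := hv0 0
  have h1 := hv0 1
  have h2 := hv0 2
  set t : ℝ := v 2 + v 1 / 2 with ht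
  have ht0 : 0 ≤ t := by positivity
  have ht1 : t ≤ 1 := by linarith
  set μ : ℝ := min t (1 - t) with hμ
  have hμ0 : 0 ≤ μ := le_min ht0 (by linarith)
  have hμv : v 1 / 2 ≤ μ := le_min (by linarith) (by linarith)
  have hs : (v 1 / 2) / μ * μ = v 1 / 2 := by
    rcases hμ0.eq_or_lt with h | h
    · rw [← h] at hμv ⊢
      linarith
    · field_simp
  refine ⟨(⟨1 - (v 1 / 2) / μ, ?_, ?_⟩, ⟨t, ht0, ht1⟩), ?_⟩
  · rw [sub_nonneg]
    exact div_le_one_of_le₀ hμv hμ0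
  · rw [sub_le_self_iff]
    positivity
  · refine Subtype.ext (funext fun k => ?_)
    fin_cases k <;> simp [squareToTriangle, ← hμ, hs] <;> linarith

/-- Points are identified only on the sides t = 0 and t = 1, where a homotopy of paths is constant;
this is why it descends to the triangle. -/
lemma squareToTriangle_fiber {z w : I × I} (h : squareToTriangle z = squareToTriangle w) :
    z.2 = w.2 ∧ (z.1 = w.1 ∨ z.2 = 0 ∨ z.2 = 1) := by
  obtain ⟨s, t⟩ := z
  obtain ⟨s', t'⟩ := w
  have h0 := congrFun (congrArg Subtype.val h) 0
  have h1 := congrFun (congrArg Subtype.val h) 1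
  simp [squareToTriangle] at h0 h1
  have ht : (t : ℝ) = t' := by linarith
  have ht' : t = t' := Subtype.ext ht
  subst ht'
  refine ⟨rfl, ?_⟩
  by_cases hm : min (t : ℝ) (1 - t) = 0
  · right
    rcases min_choice (t : ℝ) (1 - t) with h | h
    · left; exact Subtype.ext (by rw [← h, hm]; rfl)
    · right; exact Subtype.ext (by have := h.symm.trans hm; rw [Set.Icc.coe_one]; linarith)
  · left
    have := mul_right_cancel₀ hm h1
    exact Subtype.ext (by linarith)

lemma face_edge_eq (i : Fin 3) (v : stdSimplex ℝ (Fin 2)) :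
    (stdSimplex.map (S := ℝ) i.succAbove v).1 =
      match i with
      | 0 => ![0, v.1 0, v.1 1]
      | 1 => ![v.1 0, 0, v.1 1]
      | 2 => ![v.1 0, v.1 1, 0] := by
  funext k
  change FunOnFinite.linearMap ℝ ℝ i.succAbove v.1 k = _
  rw [FunOnFinite.linearMap_apply_apply, Finset.sum_filter, Fin.sum_univ_two]
  fin_cases i <;> fin_cases k <;> simp [Fin.succAbove, Fin.lt_def, Fin.ext_iff]

/-- A homotopy commutative triangle of paths is the boundary of a singular simplex. -/
lemma exists_simplex_of_homotopic {x y z : X} {p : Path x y} {q : Path y z} {r : Path x z}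
    (h : (p.trans q).Homotopic r) : ∃ f : SSimplex 2 X,
      face 0 f = pathSimplex q ∧ face 1 f = pathSimplex r ∧ face 2 f = pathSimplex p := by
  obtain ⟨H⟩ := h
  have hq : Topology.IsQuotientMap squareToTriangle :=
    squareToTriangle.continuous.isClosedMap.isQuotientMap squareToTriangle.continuous
      squareToTriangle_surjective
  have hfac : Function.FactorsThrough H.toContinuousMap squareToTriangle := by
    intro z w hzw
    obtain ⟨s, t⟩ := z
    obtain ⟨s', t'⟩ := w
    obtain ⟨h1, h2⟩ := squareToTriangle_fiber hzw
    simp only at h1 h2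
    subst h1
    rcases h2 with rfl | rfl | rfl
    · rfl
    · exact (H.source s).trans (H.source s').symm
    · exact (H.target s).trans (H.target s').symm
  let f : SSimplex 2 X := hq.lift H.toContinuousMap hfac
  have hf (z : I × I) : f (squareToTriangle z) = H z :=
    congrArg (fun g : C(I × I, X) => g z) (hq.lift_comp H.toContinuousMap hfac)
  have hv (v : stdSimplex ℝ (Fin 2)) : v.1 0 = 1 - v.1 1 := by
    have := v.2.2
    rw [Fin.sum_univ_two] at this
    linarith
  refine ⟨f, ?_, ?_, ?_⟩ <;> ext v
  · have h0 := v.2.1 0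
    have h1 := v.2.1 1
    rw [hv v] at h0
    have e : stdSimplex.map (Fin.succAbove 0) v = squareToTriangle
        (0, ⟨(1 + v.1 1) / 2, by linarith, by linarith⟩) := by
      refine Subtype.ext ((face_edge_eq 0 v).trans ?_)
      have hm : min ((1 + v.1 1) / 2) (1 - (1 + v.1 1) / 2) = 1 - (1 + v.1 1) / 2 :=
        min_eq_right (by linarith)
      funext k
      fin_cases k <;> simp [squareToTriangle, hm, hv v] <;> ring
    change f (stdSimplex.map (Fin.succAbove 0) v) = _
    rw [e, hf, H.apply_zero, pathSimplex_apply]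
    change (p.trans q) _ = _
    rw [Path.trans_apply]
    split_ifs with h
    · simp only at h
      have hv1 : v.1 1 = 0 := by linarith
      have e1 : stdSimplexHomeomorphUnitInterval v = 0 := Subtype.ext hv1
      rw [e1, q.source]
      convert p.target
      simp [hv1]
    · congr 1
      refine Subtype.ext ?_
      simp only
      change _ = v.1 1
      ring
  · have e : stdSimplex.map (Fin.succAbove 1) v = squareToTriangle
        (1, stdSimplexHomeomorphUnitInterval v) := by
      refine Subtype.ext ((face_edge_eq 1 v).trans ?_)
      funext k
      fin_cases k <;> simp [squareToTriangle, hv v]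
    change f (stdSimplex.map (Fin.succAbove 1) v) = _
    rw [e, hf, H.apply_one]
    rfl
  · have h0 := v.2.1 0
    have h1 := v.2.1 1
    rw [hv v] at h0
    have e : stdSimplex.map (Fin.succAbove 2) v = squareToTriangle
        (0, ⟨v.1 1 / 2, by linarith, by linarith⟩) := by
      refine Subtype.ext ((face_edge_eq 2 v).trans ?_)
      have hm : min (v.1 1 / 2) (1 - v.1 1 / 2) = v.1 1 / 2 := min_eq_left (by linarith)
      funext k
      fin_cases k <;> simp [squareToTriangle, hm, hv v] <;> ring
    change f (stdSimplex.map (Fin.succAbove 2) v) = _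
    rw [e, hf, H.apply_zero, pathSimplex_apply]
    change (p.trans q) _ = _
    rw [Path.trans_apply, dif_pos (by simp only; linarith)]
    congr 1
    refine Subtype.ext ?_
    simp only
    change _ = v.1 1
    ring

/-- The affine simplex with given vertices in a topological vector space. -/
def affineSimplex {V : Type*} [AddCommGroup V] [Module ℝ V] [TopologicalSpace V]
    [ContinuousAdd V] [ContinuousSMul ℝ V] {n : ℕ} (a : Fin (n + 1) → V) : SSimplex n V where
  toFun v := ∑ k, v.1 k • a k
  continuous_toFun := continuous_finsetSum _ fun k _ =>
    ((continuous_apply k).comp continuous_subtype_val).smul continuous_const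

lemma face_affineSimplex {V : Type*} [AddCommGroup V] [Module ℝ V] [TopologicalSpace V]
    [ContinuousAdd V] [ContinuousSMul ℝ V] (a : Fin 3 → V) (i : Fin 3) :
    face i (affineSimplex a) = affineSimplex (a ∘ i.succAbove) := by
  ext v
  change ∑ k, (stdSimplex.map i.succAbove v).1 k • a k = ∑ k, v.1 k • a (i.succAbove k)
  rw [Fin.sum_univ_three, face_edge_eq, Fin.sum_univ_two]
  fin_cases i <;> simp [Fin.succAbove, Fin.lt_def]

lemma face_comp {Y Z : Type*} [TopologicalSpace Y] [TopologicalSpace Z] {n : ℕ} (i : Fin (n + 2))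
    (f : C(Y, Z)) (g : SSimplex (n + 1) Y) : face i (f.comp g) = f.comp (face i g) := rfl

end Simplices

/-! ### Loops and their holonomy -/

section Unroll

variable {X : Type*} [TopologicalSpace X] {ι : Type*}

/-- The universal covering of the `i`-th circle, with period `1`. -/
def unroll (i : ι) : C(ℝ, Circles ι) :=
  (circleIncl i).comp (Circle.exp.comp (ContinuousMap.mulLeft (2 * Real.pi)))

lemma unroll_apply (i : ι) (x : ℝ) : unroll i x = ⟨i, Circle.exp (2 * Real.pi * x)⟩ := rfl

lemma unroll_periodic (i : ι) : Function.Periodic (unroll i) 1 := fun x => by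
  rw [unroll_apply, unroll_apply, mul_add, mul_one, Circle.exp_add_two_pi]

lemma unroll_eq_unroll {i k : ι} {x y : ℝ} (h : unroll i x = unroll k y) :
    i = k ∧ ∃ n : ℤ, x = y + n := by
  simp only [unroll_apply, Sigma.mk.injEq, heq_eq_eq, Circle.exp_eq_exp] at h
  obtain ⟨rfl, n, hn⟩ := h
  refine ⟨rfl, n, ?_⟩
  have : 2 * Real.pi * x = 2 * Real.pi * (y + n) := by rw [hn]; ring
  exact mul_left_cancel₀ (by positivity) this

/-- Singular simplices in a union of circles lift to the line. -/
lemma exists_lift_circles {n : ℕ} (f : SSimplex n (Circles ι)) :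
    ∃ (i : ι) (θ : SSimplex n ℝ), f = (unroll i).comp θ := by
  obtain ⟨i, g, hg, hfg⟩ := f.continuous.exists_lift_sigma
  set v : stdSimplex ℝ (Fin (n + 1)) := stdSimplex.vertex 0
  obtain ⟨F, ⟨-, hF⟩, -⟩ := Circle.isCoveringMap_exp.existsUnique_continuousMap_lifts ⟨g, hg⟩ v
    (Complex.arg (g v)) (Circle.exp_arg _)
  refine ⟨i, (ContinuousMap.mulLeft (2 * Real.pi)⁻¹).comp F, ?_⟩
  ext x : 1
  have h1 := congrFun hfg x
  have h2 := congrFun hF x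
  rw [h1]
  simp only [ContinuousMap.comp_apply, unroll_apply, ContinuousMap.coe_mulLeft, Function.comp_apply,
    ContinuousMap.coe_mk] at h2 ⊢
  rw [mul_inv_cancel_left₀ (by positivity), h2]

/-- A preferred angle of a point of a union of circles. -/
def angle (z : Circles ι) : ℝ := (2 * Real.pi)⁻¹ * Complex.arg z.2

lemma unroll_angle (z : Circles ι) : unroll z.1 (angle z) = z := by
  rw [unroll_apply, angle, mul_inv_cancel_left₀ (by positivity), Circle.exp_arg]

/-- The `i`-th loop of `γ`, as a periodic path. -/
abbrev unrollLoop (γ : C(Circles ι, X)) (i : ι) : C(ℝ, X) := γ.comp (unroll i)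

lemma unrollLoop_periodic (γ : C(Circles ι, X)) (i : ι) : Function.Periodic (unrollLoop γ i) 1 :=
  fun x => congrArg γ (unroll_periodic i x)

end Unroll

section Holonomy

variable {X : Type*} [TopologicalSpace X] [PathConnectedSpace X] {x₀ : X}

/-- The holonomy of a periodic path is invariant under translation by integers. -/
lemma holonomy_add_int {E : C(ℝ, X)} (hE : Function.Periodic E 1) (a b : ℝ) (n : ℤ) :
    holonomy x₀ E (a + n) (b + n) = holonomy x₀ E a b := by
  have h : E.comp (ContinuousMap.addRight (n : ℝ)) = E := by
    ext x
    simpa using hE.int_mul n x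
  conv_rhs => rw [← h, holonomy_comp]
  rfl

lemma holonomy_zero_int {E : C(ℝ, X)} (hE : Function.Periodic E 1) (n : ℤ) :
    holonomy x₀ E 0 n = holonomy x₀ E 0 1 ^ n := by
  have step (n : ℤ) : holonomy x₀ E 0 (n + 1 : ℤ) = holonomy x₀ E 0 1 * holonomy x₀ E 0 n := by
    rw [← holonomy_mul E 0 n, ← holonomy_add_int hE 0 1 n]
    congr 2
    · ring
    · push_cast; ring
  induction n using Int.induction_on with
  | zero => rw [Int.cast_zero, holonomy_self, zpow_zero]
  | succ n ih => rw [step, ih, zpow_add_one, (Commute.refl _).zpow_right _]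
  | pred n ih =>
    have h := step (-(n : ℤ) - 1)
    rw [sub_add_cancel, ih] at h
    rw [zpow_sub_one, (Commute.refl _).inv_right.zpow_left _ |>.eq, h, inv_mul_cancel_left]

lemma holonomy_zero_add_int {E : C(ℝ, X)} (hE : Function.Periodic E 1) (a : ℝ) (n : ℤ) :
    holonomy x₀ E 0 (a + n) = holonomy x₀ E 0 a * holonomy x₀ E 0 1 ^ n := by
  rw [← holonomy_zero_int hE, ← holonomy_mul E 0 n, ← holonomy_add_int hE 0 a n, zero_add]

variable {ι : Type*}

variable (x₀) in
/-- The element of the fundamental group given by the `i`-th loop of `γ`. -/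
def loopElt (γ : C(Circles ι, X)) (i : ι) : FundamentalGroup X x₀ :=
  holonomy x₀ (unrollLoop γ i) 0 1

/-- The free homotopy unrolls to a map Φ of the plane. Going around a unit square compares the two
loops, and by periodicity its two remaining sides have the same holonomy, which is the conjugator.
-/
lemma isConj_loopElt {γ : C(Circles ι, X)} {i : ι} {g : FundamentalGroup X x₀}
    (h : LoopCorresponds (γ.comp (circleIncl i)) g) : IsConj g (loopElt x₀ γ i) := by
  obtain ⟨f', hf', ⟨H⟩, rfl⟩ := h
  refine (isConj_toLoop _).trans ?_
  set e : C(ℝ, Circle) := Circle.exp.comp (ContinuousMap.mulLeft (2 * Real.pi)) with he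
  set Φ : C(ℝ × ℝ, X) := H.toContinuousMap.comp
    (ContinuousMap.prodMap ⟨Set.projIcc 0 1 zero_le_one, continuous_projIcc⟩ e) with hΦ
  have hper (t x : ℝ) : Φ (t, x + 1) = Φ (t, x) := by
    simp [hΦ, he, mul_add]
  let at_ (t : ℝ) : C(ℝ, ℝ × ℝ) := ⟨fun x => (t, x), by fun_prop⟩
  have h0 : loopElt x₀ γ i = holonomy x₀ Φ (0, 0) (0, 1) := by
    rw [loopElt]
    have : unrollLoop γ i = Φ.comp (at_ 0) := by
      ext x
      simp [hΦ, at_, he, unroll]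
    rw [this, holonomy_comp]
    rfl
  have h1 : toLoop x₀ (loopClass f' hf').toPath = holonomy x₀ Φ (1, 0) (1, 1) := by
    have : f'.comp e = Φ.comp (at_ 1) := by
      ext x
      simp [hΦ, at_, he]
    have h2 : holonomy x₀ (f'.comp e) 0 1 = holonomy x₀ Φ (1, 0) (1, 1) := by
      rw [this, holonomy_comp]
      rfl
    rw [← h2, holonomy]
    let p : Path (0 : ℝ) 1 := ⟨⟨fun t => (t : ℝ), continuous_subtype_val⟩, rfl, rfl⟩
    rw [pathCls_eq_map _ (Path.Homotopic.Quotient.mk p), ← Path.Homotopic.Quotient.mk_map]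
    have h3 : p.map (f'.comp e).continuous = (circlePath.map f'.continuous).cast
        (by simp [he]) (by simp [he]) := by
      ext t
      rfl
    rw [h3, Path.Homotopic.Quotient.mk_cast, toLoop_cast]
    change toLoop x₀ (Path.Homotopic.Quotient.mk (Path.cast _ _ _)) = _
    rw [Path.Homotopic.Quotient.mk_cast, toLoop_cast]
  have h2 : holonomy x₀ Φ (0, 0) (1, 0) = holonomy x₀ Φ (0, 1) (1, 1) := by
    let sh : C(ℝ × ℝ, ℝ × ℝ) := ⟨fun z => (z.1, z.2 + 1), by fun_prop⟩
    have : Φ = Φ.comp sh := by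
      ext z
      exact (hper z.1 z.2).symm
    conv_lhs => rw [this, holonomy_comp]
    simp [sh]
  rw [h0, h1]
  refine isConj_iff.2 ⟨(holonomy x₀ Φ (0, 0) (1, 0))⁻¹, ?_⟩
  rw [inv_inv, mul_assoc, holonomy_mul, ← holonomy_mul Φ (0, 0) (0, 1) (1, 1), ← h2, inv_mul_cancel_left]

end Holonomy

/-! ### Quasimorphisms and relative cycles -/

section Triangles

variable {R : Type*} [CommRing R] {Y : Type*} [TopologicalSpace Y]

lemma bd_triangle (σ : SSimplex 2 Y) : bd R Y 1 (Finsupp.single σ 1) =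
    Finsupp.single (face 0 σ) 1 - Finsupp.single (face 1 σ) 1 + Finsupp.single (face 2 σ) 1 := by
  rw [bd_single, one_smul]
  refine (Fin.sum_univ_three _).trans ?_
  simp [sub_eq_add_neg]

lemma linearCombination_bd_triangle (F : SSimplex 1 Y → R) (a : SChain R 2 Y) :
    Finsupp.linearCombination R F (bd R Y 1 a) =
      Finsupp.linearCombination R
        (fun σ : SSimplex 2 Y => F (face 0 σ) - F (face 1 σ) + F (face 2 σ)) a := by
  rw [← LinearMap.comp_apply]
  congr 1
  refine Finsupp.lhom_ext' fun σ => LinearMap.ext_ring ?_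
  simp only [LinearMap.comp_apply, Finsupp.lsingle_apply, bd_triangle]
  simp

end Triangles

section Cylinder

variable {X : Type*} [TopologicalSpace X] {ι : Type*} (γ : C(Circles ι, X))

/-- The retraction of the mapping cylinder to its base. -/
def cylRetr : C(Cyl γ, X) where
  toFun := Quot.lift (Sum.elim id fun p => γ p.1) (by rintro _ _ ⟨u⟩; rfl)
  continuous_toFun := continuous_quot_lift _ (by fun_prop)

end Cylinder

/-! ### Straightening singular edges and averaging over framings. -/

section Straightening

variable {X : Type*} [TopologicalSpace X] [PathConnectedSpace X] (x₀ : X) {ι : Type*}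
  (γ : C(Circles ι, X))

open Classical in
/-- The `s`-th choice of a path from the base point to a point of the mapping cylinder: for a point
on one of the circles at the top, the path is allowed to wind `s` times around the circle. -/
def framing (y : Cyl γ) (s : ℕ) : FundamentalGroup X x₀ :=
  if h : ∃ z, cylTop γ z = y then
    holonomy x₀ (unrollLoop γ h.choose.1) 0 (angle h.choose + s)
  else 1

lemma framing_cylTop (z : Circles ι) (s : ℕ) :
    framing x₀ γ (cylTop γ z) s = holonomy x₀ (unrollLoop γ z.1) 0 (angle z + s) := by
  have h : ∃ z', cylTop γ z' = cylTop γ z := ⟨z, rfl⟩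
  have hz : h.choose = z := cylTop_injective γ h.choose_spec
  rw [framing, dif_pos h, hz]

/-- The straightening of the edge from `a` to `b` of a simplex in the mapping cylinder. -/
def straight {n : ℕ} (f : SSimplex n (Cyl γ)) (a b : stdSimplex ℝ (Fin (n + 1))) (s t : ℕ) :
    FundamentalGroup X x₀ :=
  (framing x₀ γ (f b) t)⁻¹ * holonomy x₀ ((cylRetr γ).comp f) a b * framing x₀ γ (f a) s

lemma straight_mul {n : ℕ} (f : SSimplex n (Cyl γ)) (a b c : stdSimplex ℝ (Fin (n + 1)))
    (s t r : ℕ) :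
    straight x₀ γ f b c t r * straight x₀ γ f a b s t = straight x₀ γ f a c s r := by
  simp only [straight, ← holonomy_mul ((cylRetr γ).comp f) a b c]
  group

lemma straight_face (f : SSimplex 2 (Cyl γ)) (i : Fin 3) (s t : ℕ) :
    straight x₀ γ (face i f) (stdSimplex.vertex 0) (stdSimplex.vertex 1) s t =
      straight x₀ γ f (stdSimplex.vertex (i.succAbove 0)) (stdSimplex.vertex (i.succAbove 1))
        s t := by
  have h (a b : stdSimplex ℝ (Fin 2)) : straight x₀ γ (face i f) a b s t =
      straight x₀ γ f (stdSimplex.map i.succAbove a) (stdSimplex.map i.succAbove b) s t := by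
    simp only [straight, face]
    rw [← ContinuousMap.comp_assoc, holonomy_comp]
    rfl
  rw [h, stdSimplex.map_vertex, stdSimplex.map_vertex]

/-- The average of `ψ` over the straightenings of a singular edge, using the first `K` choices of
paths for both ends. -/
def average (ψ : FundamentalGroup X x₀ → ℝ) (K : ℕ) (f : SSimplex 1 (Cyl γ)) : ℝ :=
  (∑ s ∈ Finset.range K, ∑ t ∈ Finset.range K,
    ψ (straight x₀ γ f (stdSimplex.vertex 0) (stdSimplex.vertex 1) s t)) / (K : ℝ) ^ 2

/-- For each choice of framings at the three vertices, the straightened edges satisfy the product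
relation, so the defect bound applies; averaging over all K³ choices preserves it. -/
lemma abs_average_bd_le {ψ : FundamentalGroup X x₀ → ℝ}
    (hψ : ∀ x y, |ψ x + ψ y - ψ (x * y)| ≤ 1) {K : ℕ} (hK : K ≠ 0) (f : SSimplex 2 (Cyl γ)) :
    |average x₀ γ ψ K (face 0 f) - average x₀ γ ψ K (face 1 f) + average x₀ γ ψ K (face 2 f)| ≤
      1 := by
  have hK' : (0 : ℝ) < K := by exact_mod_cast Nat.pos_of_ne_zero hK
  set F : Fin 3 → Fin 3 → ℕ → ℕ → ℝ := fun i j s t =>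
    ψ (straight x₀ γ f (stdSimplex.vertex i) (stdSimplex.vertex j) s t) with hF
  have e (i : Fin 3) : average x₀ γ ψ K (face i f) = (∑ s ∈ Finset.range K,
      ∑ t ∈ Finset.range K, F (i.succAbove 0) (i.succAbove 1) s t) / (K : ℝ) ^ 2 := by
    simp only [average, straight_face, hF]
  have e0 := e 0
  have e1 := e 1
  have e2 := e 2
  rw [show (0 : Fin 3).succAbove 0 = 1 from rfl, show (0 : Fin 3).succAbove 1 = 2 from rfl] at e0
  rw [show (1 : Fin 3).succAbove 0 = 0 from rfl, show (1 : Fin 3).succAbove 1 = 2 from rfl] at e1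
  rw [show (2 : Fin 3).succAbove 0 = 0 from rfl, show (2 : Fin 3).succAbove 1 = 1 from rfl] at e2
  have key : |∑ a ∈ Finset.range K, ∑ b ∈ Finset.range K, ∑ c ∈ Finset.range K,
      (F 1 2 b c + F 0 1 a b - F 0 2 a c)| ≤ (K : ℝ) ^ 3 := by
    have h1 (a b c : ℕ) : |F 1 2 b c + F 0 1 a b - F 0 2 a c| ≤ 1 := by
      simp only [hF]
      rw [← straight_mul x₀ γ f (stdSimplex.vertex 0) (stdSimplex.vertex 1) (stdSimplex.vertex 2)
        a b c]
      exact hψ _ _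
    calc _ ≤ ∑ a ∈ Finset.range K, ∑ b ∈ Finset.range K, ∑ c ∈ Finset.range K, (1 : ℝ) := by
          refine (Finset.abs_sum_le_sum_abs _ _).trans (Finset.sum_le_sum fun a _ => ?_)
          refine (Finset.abs_sum_le_sum_abs _ _).trans (Finset.sum_le_sum fun b _ => ?_)
          exact (Finset.abs_sum_le_sum_abs _ _).trans (Finset.sum_le_sum fun c _ => h1 a b c)
      _ = _ := by simp; ring
  -- An edge does not see the framing of the opposite vertex, so that choice contributes a factor K.
  have hsum : ∑ a ∈ Finset.range K, ∑ b ∈ Finset.range K, ∑ c ∈ Finset.range K,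
      (F 1 2 b c + F 0 1 a b - F 0 2 a c) =
      K * (∑ s ∈ Finset.range K, ∑ t ∈ Finset.range K, F 1 2 s t -
        ∑ s ∈ Finset.range K, ∑ t ∈ Finset.range K, F 0 2 s t +
        ∑ s ∈ Finset.range K, ∑ t ∈ Finset.range K, F 0 1 s t) := by
    simp only [Finset.sum_sub_distrib, Finset.sum_add_distrib, Finset.sum_const,
      Finset.card_range, nsmul_eq_mul, ← Finset.mul_sum]
    ring
  rw [hsum, abs_mul, Nat.abs_cast] at key
  rw [e0, e1, e2, ← sub_div, ← add_div, abs_div, abs_of_pos (by positivity : (0 : ℝ) < (K : ℝ) ^ 2),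
    div_le_one (by positivity)]
  nlinarith

/-- The winding number of the arc `θ`, relative to the preferred angles of its ends. -/
def winding (i : ι) (θ : SSimplex 1 ℝ) : ℝ :=
  (angle (unroll i (θ (stdSimplex.vertex 0))) - θ (stdSimplex.vertex 0)) -
    (angle (unroll i (θ (stdSimplex.vertex 1))) - θ (stdSimplex.vertex 1))

/-- With framings s and t, an arc on the i-th top circle straightens to the power s + w - t of the
loop element, w being its winding number. Averaging over s and t replaces ψ by its homogenization in
the limit. -/
lemma tendsto_average {ψ : FundamentalGroup X x₀ → ℝ} (hodd : ∀ g, ψ g⁻¹ = -ψ g) {h : ι → ℝ}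
    (hh : ∀ i (n : ℤ), |ψ (loopElt x₀ γ i ^ n) - n * h i| ≤ 1) (i : ι) (θ : SSimplex 1 ℝ) :
    Filter.Tendsto (fun K => average x₀ γ ψ K ((cylTop γ).comp ((unroll i).comp θ))) Filter.atTop
      (nhds (winding i θ * h i)) := by
  have hang (x : ℝ) : ∃ n : ℤ, angle (unroll i x) = x + n :=
    (unroll_eq_unroll (unroll_angle (unroll i x))).2
  set v₀ : stdSimplex ℝ (Fin 2) := stdSimplex.vertex 0 with hv₀
  set v₁ : stdSimplex ℝ (Fin 2) := stdSimplex.vertex 1 with hv₁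
  obtain ⟨a, ha⟩ := hang (θ v₀)
  obtain ⟨b, hb⟩ := hang (θ v₁)
  have hw : winding i θ = ((a - b : ℤ) : ℝ) := by
    rw [winding, ← hv₀, ← hv₁, ha, hb]
    push_cast
    ring
  have hper := unrollLoop_periodic γ i
  have hfr (v : stdSimplex ℝ (Fin 2)) (n : ℤ) (hn : angle (unroll i (θ v)) = θ v + n) (s : ℕ) :
      framing x₀ γ ((cylTop γ).comp ((unroll i).comp θ) v) s =
        holonomy x₀ (unrollLoop γ i) 0 (θ v) * loopElt x₀ γ i ^ (n + s) := by
    have h1 := framing_cylTop x₀ γ (unroll i (θ v)) s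
    refine h1.trans ?_
    rw [loopElt, ← holonomy_zero_add_int hper, hn]
    push_cast
    rw [add_assoc]
    rfl
  have hst (s t : ℕ) : straight x₀ γ ((cylTop γ).comp ((unroll i).comp θ)) v₀ v₁ s t =
      loopElt x₀ γ i ^ ((s : ℤ) + (a - b) - t) := by
    have h1 : (cylRetr γ).comp ((cylTop γ).comp ((unroll i).comp θ)) = (unrollLoop γ i).comp θ := rfl
    rw [straight, hfr _ _ ha, hfr _ _ hb, h1, holonomy_comp (unrollLoop γ i) θ,
      ← holonomy_mul (unrollLoop γ i) (θ v₀) 0 (θ v₁)]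
    have h2 : holonomy x₀ (unrollLoop γ i) (θ v₀) 0 * holonomy x₀ (unrollLoop γ i) 0 (θ v₀) = 1 := by
      rw [holonomy_mul, holonomy_self]
    rw [mul_inv_rev, mul_assoc, mul_assoc, mul_assoc, inv_mul_cancel_left,
      ← mul_assoc (holonomy x₀ (unrollLoop γ i) (θ v₀) 0), h2, one_mul, ← zpow_neg, ← zpow_add]
    congr 1
    ring
  have hbound (K : ℕ) (hK : K ≠ 0) :
      |average x₀ γ ψ K ((cylTop γ).comp ((unroll i).comp θ)) - ((a - b : ℤ) : ℝ) * h i| ≤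
        2 * |((a - b : ℤ) : ℝ)| / K := by
    simp only [average, ← hv₀, ← hv₁, hst]
    exact abs_average_sub_le (fun n : ℤ => ψ (loopElt x₀ γ i ^ n))
      (fun n => by rw [zpow_neg, hodd]) (hh i) (a - b) hK
  rw [hw, tendsto_iff_dist_tendsto_zero]
  refine squeeze_zero' (Filter.Eventually.of_forall fun _ => dist_nonneg) ?_
    (tendsto_const_div_atTop_nhds_zero_nat (2 * |((a - b : ℤ) : ℝ)|))
  filter_upwards [Filter.eventually_ne_atTop 0] with K hK
  rw [Real.dist_eq]
  exact hbound K hK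

/-- An odd quasimorphism of defect at most `1` which is at distance at most `1` from the
homomorphisms `n ↦ n * h i` on the loops `γ i` bounds the `ℓ¹`-norm of a relative cycle whose
boundary is homologous to the fundamental cycle. -/
lemma sum_le_norm1 [Fintype ι] {ψ : FundamentalGroup X x₀ → ℝ} (hodd : ∀ g, ψ g⁻¹ = -ψ g)
    (hψ : ∀ x y, |ψ x + ψ y - ψ (x * y)| ≤ 1) {h : ι → ℝ}
    (hh : ∀ i (n : ℤ), |ψ (loopElt x₀ γ i ^ n) - n * h i| ≤ 1) (a : SChain ℝ 2 (Cyl γ))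
    (e : SChain ℝ 1 (Circles ι)) (f : SChain ℝ 2 (Circles ι))
    (ha : bd ℝ (Cyl γ) 1 a = push ℝ 1 (cylTop γ) e)
    (he : e = circlesCycle ℝ ι + bd ℝ (Circles ι) 1 f) : ∑ i, h i ≤ norm1 a := by
  have hex (τ : SSimplex 1 (Circles ι)) : ∃ l : ℝ, Filter.Tendsto
      (fun K => average x₀ γ ψ K ((cylTop γ).comp τ)) Filter.atTop (nhds l) := by
    obtain ⟨i, θ, rfl⟩ := exists_lift_circles τ
    exact ⟨_, tendsto_average x₀ γ hodd hh i θ⟩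
  choose Θ hΘ using hex
  have hΘ' (i : ι) (θ : SSimplex 1 ℝ) : Θ ((unroll i).comp θ) = winding i θ * h i :=
    tendsto_nhds_unique (hΘ _) (tendsto_average x₀ γ hodd hh i θ)
  -- On a triangle lifted to the line, the winding of an edge is a difference of values at its ends,
  -- so the three edges cancel.
  have hbd : Finsupp.linearCombination ℝ Θ (bd ℝ (Circles ι) 1 f) = 0 := by
    rw [linearCombination_bd_triangle]
    refine (congrArg (Finsupp.linearCombination ℝ · f) (funext fun σ => ?_)).trans
      (Finsupp.linearCombination_zero_apply ℝ f)
    obtain ⟨i, θ, rfl⟩ := exists_lift_circles σ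
    have hface (k : Fin 3) : Θ (face k ((unroll i).comp θ)) =
        ((angle (unroll i (θ (stdSimplex.vertex (k.succAbove 0)))) -
            θ (stdSimplex.vertex (k.succAbove 0))) -
          (angle (unroll i (θ (stdSimplex.vertex (k.succAbove 1)))) -
            θ (stdSimplex.vertex (k.succAbove 1)))) * h i := by
      have h1 : face k ((unroll i).comp θ) = (unroll i).comp (face k θ) := rfl
      rw [h1, hΘ', winding]
      simp only [face, ContinuousMap.comp_apply, ContinuousMap.coe_mk, stdSimplex.map_vertex]
    have h0 := hface 0
    have h1 := hface 1
    have h2 := hface 2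
    rw [show (0 : Fin 3).succAbove 0 = 1 from rfl, show (0 : Fin 3).succAbove 1 = 2 from rfl]
      at h0
    rw [show (1 : Fin 3).succAbove 0 = 0 from rfl, show (1 : Fin 3).succAbove 1 = 2 from rfl]
      at h1
    rw [show (2 : Fin 3).succAbove 0 = 0 from rfl, show (2 : Fin 3).succAbove 1 = 1 from rfl]
      at h2
    rw [h0, h1, h2, Pi.zero_apply]
    ring
  have hcyc : Finsupp.linearCombination ℝ Θ (circlesCycle ℝ ι) = ∑ i, h i := by
    rw [circlesCycle, map_sum]
    refine Finset.sum_congr rfl fun i _ => ?_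
    let θ : SSimplex 1 ℝ := ⟨fun x => (x : Fin 2 → ℝ) 1,
      (continuous_apply 1).comp continuous_subtype_val⟩
    have h1 : circleSimplex i = (unroll i).comp θ := rfl
    -- Both ends of the full turn have the same preferred angle, while the lift advances by 1.
    have h2 : winding i θ = 1 := by
      have h3 : θ (stdSimplex.vertex 0) = 0 := by simp [θ]
      have h4 : θ (stdSimplex.vertex 1) = 1 := by simp [θ]
      have h5 := unroll_periodic i 0
      rw [winding, h3, h4, ← h5]
      simp
    rw [Finsupp.linearCombination_single, one_smul, h1, hΘ', h2, one_mul]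
  have hlim : Filter.Tendsto (fun K => Finsupp.linearCombination ℝ (average x₀ γ ψ K)
      (push ℝ 1 (cylTop γ) e)) Filter.atTop (nhds (∑ i, h i)) := by
    have h1 : Finsupp.linearCombination ℝ Θ e = ∑ i, h i := by
      rw [he, map_add, hbd, hcyc, add_zero]
    rw [← h1]
    have h2 (K : ℕ) : Finsupp.linearCombination ℝ (average x₀ γ ψ K) (push ℝ 1 (cylTop γ) e) =
        ∑ τ ∈ e.support, e τ • average x₀ γ ψ K ((cylTop γ).comp τ) := by
      rw [push, Finsupp.lmapDomain_apply, Finsupp.linearCombination_mapDomain,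
        Finsupp.linearCombination_apply, Finsupp.sum]
      rfl
    simp only [h2, Finsupp.linearCombination_apply, Finsupp.sum]
    exact tendsto_finsetSum _ fun τ _ => (hΘ τ).const_smul (e τ)
  refine le_of_tendsto hlim ?_
  filter_upwards [Filter.eventually_ne_atTop 0] with K hK
  rw [← ha]
  rw [linearCombination_bd_triangle]
  refine (le_abs_self _).trans ?_
  simpa using abs_linearCombination_le _ (abs_average_bd_le x₀ γ hψ hK) a

end Straightening

/-! ### The Gromov seminorm bounds stable commutator length -/

section Seminorm

variable {Y : Type*} [TopologicalSpace Y]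

lemma l1Norm_eq {n : ℕ} (a : SChain ℝ n Y) : l1Norm a = ENNReal.ofReal (norm1 a) := by
  rw [l1Norm, norm1, Finsupp.sum, Finsupp.sum, ENNReal.ofReal_sum_of_nonneg]
  exact fun _ _ => abs_nonneg _

lemma norm1_toRealChain {n : ℕ} (a : SChain ℚ n Y) : norm1 (toRealChain n a) = norm1 a := by
  have h : (toRealChain n a).support ⊆ a.support :=
    Finsupp.support_mapRange (hf := map_zero _)
  rw [norm1_eq_sum _ h, norm1, Finsupp.sum]
  push_cast
  rfl

variable {X : Type*} [TopologicalSpace X] {ι : Type*} {γ : C(Circles ι, X)}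

lemma gromovNorm_relClass_le (a : relCycles ℚ 1 (cylTop γ)) :
    gromovNorm γ (relClass ℚ 1 (cylTop γ) a) ≤
      ENNReal.ofReal (norm1 (a : SChain ℚ 2 (Cyl γ)) : ℚ) := by
  unfold gromovNorm l1Seminorm
  refine iInf₂_le_of_le (toRealCycle 1 (cylTop γ) a) rfl (le_of_eq ?_)
  rw [l1Norm_eq]
  exact congrArg ENNReal.ofReal (norm1_toRealChain _)

variable [Fintype ι]

lemma boundary_relClass_eq_iff (a : relCycles ℚ 1 (cylTop γ)) :
    H2.boundary ℚ γ (relClass ℚ 1 (cylTop γ) a) = circlesClass ℚ ι ↔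
      ∃ f, bdInSub ℚ 1 (cylTop_injective γ) a = circlesCycle ℚ ι + bd ℚ (Circles ι) 1 f := by
  have h1 : H2.boundary ℚ γ (relClass ℚ 1 (cylTop γ) a) =
      Submodule.Quotient.mk ⟨bdInSub ℚ 1 (cylTop_injective γ) a, bd_bdInSub ℚ 0 _ a⟩ := rfl
  rw [h1, circlesClass, Submodule.Quotient.eq]
  constructor
  · rintro ⟨f, hf⟩
    exact ⟨f, by rw [hf]; simp⟩
  · rintro ⟨f, hf⟩
    exact ⟨f, by simp [hf]⟩

lemma toRealChain_circlesCycle : toRealChain 1 (circlesCycle ℚ ι) = circlesCycle ℝ ι := by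
  simp [circlesCycle, toRealChain_single]

/-- The boundary of a real representative of a rational class bounding the fundamental class. -/
lemma exists_bd_eq_of_relClass_eq {a : relCycles ℝ 1 (cylTop γ)} {α : H2 ℚ γ}
    (hα : H2.boundary ℚ γ α = circlesClass ℚ ι)
    (ha : relClass ℝ 1 (cylTop γ) a = toRealClass 1 (cylTop γ) α) :
    ∃ f, bd ℝ (Cyl γ) 1 (a : SChain ℝ 2 (Cyl γ)) =
      push ℝ 1 (cylTop γ) (circlesCycle ℝ ι + bd ℝ (Circles ι) 1 f) := by
  obtain ⟨q, rfl⟩ : ∃ q, relClass ℚ 1 (cylTop γ) q = α := Submodule.mkQ_surjective _ α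
  obtain ⟨f, hf⟩ := (boundary_relClass_eq_iff q).1 hα
  have h1 : relClass ℝ 1 (cylTop γ) a = relClass ℝ 1 (cylTop γ) (toRealCycle 1 (cylTop γ) q) := ha
  have h1' : (a : SChain ℝ 2 (Cyl γ)) - toRealChain 2 (q : SChain ℚ 2 (Cyl γ)) ∈
      relBoundaries ℝ 1 (cylTop γ) :=
    (Submodule.Quotient.eq ((relBoundaries ℝ 1 (cylTop γ)).comap
      (relCycles ℝ 1 (cylTop γ)).subtype)).1 h1
  obtain ⟨_, ⟨b, rfl⟩, _, ⟨e, rfl⟩, h⟩ := Submodule.mem_sup.1 h1'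
  -- Passing to another real representative adds ∂b, which has no boundary, and a chain e in the
  -- circles, which changes the boundary only by ∂e.
  have h2 : (a : SChain ℝ 2 (Cyl γ)) = toRealChain 2 (q : SChain ℚ 2 (Cyl γ)) +
      (bd ℝ (Cyl γ) 2 b + push ℝ 2 (cylTop γ) e) := by
    rw [h, add_sub_cancel]
  refine ⟨toRealChain 2 f + e, ?_⟩
  have h3 : bd ℝ (Cyl γ) 1 (toRealChain 2 (q : SChain ℚ 2 (Cyl γ))) =
      push ℝ 1 (cylTop γ) (circlesCycle ℝ ι + bd ℝ (Circles ι) 1 (toRealChain 2 f)) := by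
    rw [bd_toRealChain, ← push_bdInSub ℚ 1 (cylTop_injective γ) q, hf, ← push_toRealChain,
      map_add (toRealChain 1), toRealChain_circlesCycle, ← bd_toRealChain]
  have h4 : bd ℝ (Cyl γ) 1 (bd ℝ (Cyl γ) 2 b) = 0 := bd_bd ℝ b
  have h5 : bd ℝ (Cyl γ) 1 (push ℝ 2 (cylTop γ) e) =
      push ℝ 1 (cylTop γ) (bd ℝ (Circles ι) 1 e) := bd_push ℝ _ e
  rw [h2, map_add, map_add, h3, h4, h5, zero_add, ← map_add, map_add (bd ℝ (Circles ι) 1),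
    add_assoc]

variable [PathConnectedSpace X] (x₀ : X)

lemma sclSum_loopElt_le_gromovNorm {α : H2 ℚ γ} (hα : H2.boundary ℚ γ α = circlesClass ℚ ι) :
    sclSum (Finset.univ.toList.map (loopElt x₀ γ)) ≤ 1 / 4 * gromovNorm γ α := by
  rw [gromovNorm, l1Seminorm, ENNReal.mul_iInf_of_ne (by simp) (by simp)]
  refine le_iInf fun a => ?_
  rw [ENNReal.mul_iInf_of_ne (by simp) (by simp)]
  refine le_iInf fun ha => ?_
  obtain ⟨f, hf⟩ := exists_bd_eq_of_relClass_eq hα ha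
  refine (sclSum_le_of_forall_quasimorphism_le (loopElt x₀ γ) (norm1_nonneg _)
    fun ψ h hodd hψ hh => sum_le_norm1 x₀ γ hodd hψ hh _ _ f hf rfl).trans_eq ?_
  rw [l1Norm_eq, div_eq_inv_mul, ENNReal.ofReal_mul (by norm_num), one_div,
    ENNReal.ofReal_inv_of_pos (by norm_num)]
  simp

end Seminorm

/-! ### Stable commutator length bounds the Gromov seminorm -/

section AffineTriangles

variable {R : Type*} [CommRing R] {Y : Type*} [TopologicalSpace Y]
  {V : Type*} [AddCommGroup V] [Module ℝ V] [TopologicalSpace V] [ContinuousAdd V]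
  [ContinuousSMul ℝ V]

lemma bd_comp_affineSimplex (f : C(V, Y)) (a b c : V) :
    bd R Y 1 (Finsupp.single (f.comp (affineSimplex ![a, b, c])) 1) =
      Finsupp.single (f.comp (affineSimplex ![b, c])) 1 -
        Finsupp.single (f.comp (affineSimplex ![a, c])) 1 +
        Finsupp.single (f.comp (affineSimplex ![a, b])) 1 := by
  have h0 : ![a, b, c] ∘ (0 : Fin 3).succAbove = ![b, c] := by ext k; fin_cases k <;> rfl
  have h1 : ![a, b, c] ∘ (1 : Fin 3).succAbove = ![a, c] := by ext k; fin_cases k <;> rfl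
  have h2 : ![a, b, c] ∘ (2 : Fin 3).succAbove = ![a, b] := by ext k; fin_cases k <;> rfl
  rw [bd_triangle]
  simp only [face_comp]
  rw [face_affineSimplex, face_affineSimplex, face_affineSimplex, h0, h1, h2]

lemma affineSimplex_edge_apply (a b : V) (v : stdSimplex ℝ (Fin 2)) :
    affineSimplex ![a, b] v = v.1 0 • a + v.1 1 • b := by
  change ∑ k, v.1 k • ![a, b] k = _
  simp [Fin.sum_univ_two]

end AffineTriangles

/-! ### Multiple loops and their cylinders. -/

section Circles

variable {ι : Type*} (R : Type*) [CommRing R]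

/-- The singular simplex running `n` times around the `i`-th circle. -/
def multiLoop (i : ι) (n : ℕ) : SSimplex 1 (Circles ι) :=
  (unroll i).comp (affineSimplex ![(0 : ℝ), n])

lemma unroll_comp_affineSimplex_succ (i : ι) (n : ℕ) :
    (unroll i).comp (affineSimplex ![(n : ℝ), n + 1]) = circleSimplex i := by
  ext v : 1
  have hv : v.1 0 + v.1 1 = 1 := by simpa [Fin.sum_univ_two] using v.2.2
  have h1 : v.1 0 • (n : ℝ) + v.1 1 • ((n : ℝ) + 1) = v.1 1 + n := by
    simp only [smul_eq_mul]
    linear_combination (n : ℝ) * hv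
  have h2 := (unroll_periodic i).nat_mul n (v.1 1)
  rw [mul_one] at h2
  rw [ContinuousMap.comp_apply, affineSimplex_edge_apply, h1, h2]
  rfl

/-- The triangle 0, n, n + 1 on the line splits off one turn at a time; for n = 0, a constant
triangle has the constant edge as its boundary. -/
lemma exists_multiLoop_eq (i : ι) (n : ℕ) : ∃ f, Finsupp.single (multiLoop i n) (1 : R) =
    (n : R) • Finsupp.single (circleSimplex i) 1 + bd R (Circles ι) 1 f := by
  induction n with
  | zero =>
    refine ⟨Finsupp.single ((unroll i).comp (affineSimplex ![(0 : ℝ), 0, 0])) 1, ?_⟩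
    rw [bd_comp_affineSimplex]
    simp [multiLoop]
  | succ n ih =>
    obtain ⟨f, hf⟩ := ih
    refine ⟨f - Finsupp.single ((unroll i).comp (affineSimplex ![(0 : ℝ), n, n + 1])) 1, ?_⟩
    rw [map_sub, bd_comp_affineSimplex, unroll_comp_affineSimplex_succ]
    have h : (unroll i).comp (affineSimplex ![(0 : ℝ), n]) = multiLoop i n := rfl
    have h' : (unroll i).comp (affineSimplex ![(0 : ℝ), n + 1]) = multiLoop i (n + 1) := by
      simp [multiLoop]
    rw [h, h', hf]
    push_cast
    rw [add_smul, one_smul]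
    abel

end Circles

section Strip

variable {X : Type*} [TopologicalSpace X] {ι : Type*} (γ : C(Circles ι, X))

/-- The inclusion of the base of the mapping cylinder. -/
def cylBase : C(X, Cyl γ) where
  toFun x := Quot.mk _ (Sum.inl x)
  continuous_toFun := continuous_quot_mk.comp (by fun_prop)

/-- The universal cover of the `i`-th cylinder, extended to a map on the plane. -/
def strip (i : ι) : C(ℝ × ℝ, Cyl γ) where
  toFun z := Quot.mk _ (Sum.inr (unroll i z.1, Set.projIcc 0 1 zero_le_one z.2))
  continuous_toFun := continuous_quot_mk.comp <| continuous_inr.comp <|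
    ((unroll i).continuous.comp continuous_fst).prodMk (continuous_projIcc.comp continuous_snd)

/-- The rectangle of width n over the cylinder is cut into two triangles. Its vertical sides agree
by periodicity and cancel, so the norm is at most 2 for every n. -/
lemma exists_bd_eq_multiLoop_sub (i : ι) (n : ℕ) : ∃ a : SChain ℚ 2 (Cyl γ),
    bd ℚ (Cyl γ) 1 a = Finsupp.single ((cylTop γ).comp (multiLoop i n)) 1 -
      Finsupp.single ((cylBase γ).comp (γ.comp (multiLoop i n))) 1 ∧ norm1 a ≤ 2 := by
  have htop : (strip γ i).comp (affineSimplex ![((0 : ℝ), (1 : ℝ)), ((n : ℝ), 1)]) =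
      (cylTop γ).comp (multiLoop i n) := by
    ext v : 1
    have hv : v.1 0 + v.1 1 = 1 := by simpa [Fin.sum_univ_two] using v.2.2
    simp only [multiLoop, ContinuousMap.comp_apply, affineSimplex_edge_apply]
    simp [strip, cylTop, hv]
  have hbot : (strip γ i).comp (affineSimplex ![((0 : ℝ), (0 : ℝ)), ((n : ℝ), 0)]) =
      (cylBase γ).comp (γ.comp (multiLoop i n)) := by
    ext v : 1
    simp only [multiLoop, ContinuousMap.comp_apply, affineSimplex_edge_apply]
    refine Eq.trans ?_ (Quot.sound (CylRel.glue _))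
    simp [strip]
  have hside : (strip γ i).comp (affineSimplex ![((n : ℝ), (0 : ℝ)), ((n : ℝ), 1)]) =
      (strip γ i).comp (affineSimplex ![((0 : ℝ), (0 : ℝ)), ((0 : ℝ), 1)]) := by
    ext v : 1
    have hv : v.1 0 + v.1 1 = 1 := by simpa [Fin.sum_univ_two] using v.2.2
    have h2 := (unroll_periodic i).nat_mul n 0
    simp only [mul_one, zero_add] at h2
    simp only [ContinuousMap.comp_apply, affineSimplex_edge_apply]
    simp [strip, ← add_mul, hv, h2]
  refine ⟨Finsupp.single ((strip γ i).comp
      (affineSimplex ![((0 : ℝ), (0 : ℝ)), ((0 : ℝ), 1), ((n : ℝ), 1)])) 1 -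
    Finsupp.single ((strip γ i).comp
      (affineSimplex ![((0 : ℝ), (0 : ℝ)), ((n : ℝ), 0), ((n : ℝ), 1)])) 1, ?_, ?_⟩
  · rw [map_sub, bd_comp_affineSimplex, bd_comp_affineSimplex, htop, hbot, hside]
    abel
  · refine (norm1_sub_le _ _).trans ?_
    norm_num

end Strip

/-! ### From products of commutators to relative cycles. -/

section Fillings

variable {X : Type*} [TopologicalSpace X] [PathConnectedSpace X] {x₀ : X}

open Path.Homotopic.Quotient (mk)

lemma exists_bd_eq_of_toLoop {x y z : X} {p : Path x y} {q : Path y z} {r : Path x z}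
    (h : toLoop x₀ (mk q) * toLoop x₀ (mk p) = toLoop x₀ (mk r)) :
    ∃ σ : SSimplex 2 X, bd ℚ X 1 (Finsupp.single σ 1) =
      Finsupp.single (pathSimplex q) 1 - Finsupp.single (pathSimplex r) 1 +
        Finsupp.single (pathSimplex p) 1 := by
  rw [← toLoop_trans, ← Path.Homotopic.Quotient.mk_trans] at h
  obtain ⟨σ, h0, h1, h2⟩ := exists_simplex_of_homotopic
    (Path.Homotopic.Quotient.exact (toLoop_injective h))
  exact ⟨σ, by rw [bd_triangle, h0, h1, h2]⟩

lemma exists_path_toLoop_eq (x y : X) (g : FundamentalGroup X x₀) :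
    ∃ p : Path x y, toLoop x₀ (mk p) = g := by
  obtain ⟨q, hq⟩ := toLoop_surjective (a := x) (b := y) g
  obtain ⟨p, rfl⟩ := Path.Homotopic.Quotient.mk_surjective q
  exact ⟨p, hq⟩

/-- An annulus made of two triangles: κ joins the base points with trivial holonomy, and the
diagonal m is homotopic both to κ followed by p and to q followed by κ. -/
lemma exists_bd_eq_sub_of_toLoop_eq {y z : X} (p : Path y y) (q : Path z z)
    (h : toLoop x₀ (mk p) = toLoop x₀ (mk q)) : ∃ a : SChain ℚ 2 X,
    bd ℚ X 1 a = Finsupp.single (pathSimplex p) 1 - Finsupp.single (pathSimplex q) 1 ∧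
      norm1 a ≤ 2 := by
  obtain ⟨κ, hκ⟩ := exists_path_toLoop_eq z y (1 : FundamentalGroup X x₀)
  obtain ⟨m, hm⟩ := exists_path_toLoop_eq z y (toLoop x₀ (mk p))
  obtain ⟨σ, hσ⟩ := exists_bd_eq_of_toLoop (x₀ := x₀) (p := κ) (q := p) (r := m)
    (by rw [hκ, hm, mul_one])
  obtain ⟨τ, hτ⟩ := exists_bd_eq_of_toLoop (x₀ := x₀) (p := q) (q := κ) (r := m)
    (by rw [hκ, hm, one_mul, h])
  refine ⟨Finsupp.single σ 1 - Finsupp.single τ 1, ?_, ?_⟩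
  · rw [map_sub, hσ, hτ]
    abel
  · refine (norm1_sub_le _ _).trans ?_
    norm_num

/-- Bar chains are realized by singular chains with the same norm. -/
lemma exists_bd_eq_mapDomain_barBd (ρ : FundamentalGroup X x₀ → Path x₀ x₀)
    (hρ : ∀ g, toLoop x₀ (mk (ρ g)) = g) (b : FundamentalGroup X x₀ × FundamentalGroup X x₀ →₀ ℚ) :
    ∃ a : SChain ℚ 2 X, bd ℚ X 1 a =
      Finsupp.lmapDomain ℚ ℚ (fun g => pathSimplex (ρ g)) (barBd _ ℚ b) ∧ norm1 a ≤ norm1 b := by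
  have hex (p : FundamentalGroup X x₀ × FundamentalGroup X x₀) :=
    exists_bd_eq_of_toLoop (x₀ := x₀) (p := ρ p.2) (q := ρ p.1) (r := ρ (p.1 * p.2))
      (by rw [hρ, hρ, hρ])
  choose Φ hΦ using hex
  refine ⟨Finsupp.lmapDomain ℚ ℚ Φ b, ?_, norm1_mapDomain_le Φ b⟩
  rw [← LinearMap.comp_apply, ← LinearMap.comp_apply]
  congr 1
  refine Finsupp.lhom_ext' fun p => LinearMap.ext_ring ?_
  simp only [LinearMap.comp_apply, Finsupp.lsingle_apply, Finsupp.lmapDomain_apply,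
    Finsupp.mapDomain_single, hΦ]
  rw [barBd_single, one_smul, ← Finsupp.lmapDomain_apply ℚ ℚ, map_sub, map_add]
  simp only [Finsupp.lmapDomain_apply, Finsupp.mapDomain_single]
  abel

variable {ι : Type*} (γ : C(Circles ι, X))

lemma exists_path_multiLoop (i : ι) (n : ℕ) : ∃ (y : X) (p : Path y y),
    pathSimplex p = γ.comp (multiLoop i n) ∧ toLoop x₀ (mk p) = loopElt x₀ γ i ^ n := by
  have hper : unrollLoop γ i n = unrollLoop γ i 0 := by
    have := (unrollLoop_periodic γ i).nat_mul n 0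
    simpa using this
  let l : Path (0 : ℝ) n := ⟨⟨fun t => t * n, by fun_prop⟩, by simp, by simp⟩
  refine ⟨unrollLoop γ i 0, (l.map (unrollLoop γ i).continuous).cast rfl hper.symm, ?_, ?_⟩
  · ext v : 1
    have h : affineSimplex ![(0 : ℝ), n] v = v.1 1 * n := by
      rw [affineSimplex_edge_apply, smul_zero, zero_add, smul_eq_mul]
    exact congrArg (unrollLoop γ i) h.symm
  · rw [Path.Homotopic.Quotient.mk_cast, toLoop_cast, Path.Homotopic.Quotient.mk_map,
      ← pathCls_eq_map]
    have h := holonomy_zero_int (x₀ := x₀) (unrollLoop_periodic γ i) n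
    rw [zpow_natCast] at h
    exact_mod_cast h

variable [Fintype ι]

/-- The bar filling has norm at most 4k + 3|ι| + 2. For each loop, two triangles exchange the chosen
based representative of the power for the actual n-fold loop, and two more carry it up the cylinder.
-/
lemma exists_relCycle {k n : ℕ}
    (h : SumCommProd k ((Finset.univ.toList.map (loopElt x₀ γ)).map (· ^ n))) :
    ∃ a : SChain ℚ 2 (Cyl γ),
      bd ℚ (Cyl γ) 1 a = push ℚ 1 (cylTop γ) (∑ i, Finsupp.single (multiLoop i n) 1) ∧
      norm1 a ≤ 4 * k + (7 * Fintype.card ι + 2) := by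
  obtain ⟨b, hb, hbn⟩ := h.exists_barBd_eq
  choose ρ hρ using exists_path_toLoop_eq x₀ x₀ (x₀ := x₀)
  obtain ⟨a, ha, han⟩ := exists_bd_eq_mapDomain_barBd ρ hρ b
  have hloop (i : ι) : ∃ c : SChain ℚ 2 X, bd ℚ X 1 c =
      Finsupp.single (γ.comp (multiLoop i n)) 1 -
        Finsupp.single (pathSimplex (ρ (loopElt x₀ γ i ^ n))) 1 ∧ norm1 c ≤ 2 := by
    obtain ⟨y, p, hp, hp'⟩ := exists_path_multiLoop (x₀ := x₀) γ i n
    rw [← hp]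
    exact exists_bd_eq_sub_of_toLoop_eq p _ (by rw [hp', hρ])
  choose c hc hcn using hloop
  choose d hd hdn using fun i => exists_bd_eq_multiLoop_sub γ i n
  have hbase : bd ℚ X 1 (a + ∑ i, c i) = ∑ i, Finsupp.single (γ.comp (multiLoop i n)) 1 := by
    rw [map_add, ha, hb, map_sum]
    simp only [hc, Finset.sum_sub_distrib]
    rw [List.map_map, List.map_map, Finset.sum_map_toList, map_sum]
    simp
  refine ⟨push ℚ 2 (cylBase γ) (a + ∑ i, c i) + ∑ i, d i, ?_, ?_⟩
  · rw [map_add, bd_push, hbase, map_sum, map_sum, map_sum]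
    simp only [hd, push_single, Finset.sum_sub_distrib]
    abel
  · have h1 : norm1 (∑ i, c i) ≤ 2 * Fintype.card ι := by
      refine (norm1_sum_le _ _).trans ((Finset.sum_le_sum fun i _ => hcn i).trans_eq ?_)
      simp [mul_comm]
    have h2 : norm1 (∑ i, d i) ≤ 2 * Fintype.card ι := by
      refine (norm1_sum_le _ _).trans ((Finset.sum_le_sum fun i _ => hdn i).trans_eq ?_)
      simp [mul_comm]
    have h3 : norm1 (push ℚ 2 (cylBase γ) (a + ∑ i, c i)) ≤ norm1 (a + ∑ i, c i) :=
      norm1_mapDomain_le _ _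
    have h4 := norm1_add_le a (∑ i, c i)
    have h5 := norm1_add_le (push ℚ 2 (cylBase γ) (a + ∑ i, c i)) (∑ i, d i)
    simp only [List.length_map, Finset.length_toList, Finset.card_univ] at hbn
    linarith

/-- The n-fold loops are homologous in the circles to n times the fundamental cycle, so the relative
cycle may be divided by n. -/
lemma exists_gromovNorm_le {k n : ℕ} (hn : n ≠ 0)
    (h : SumCommProd k ((Finset.univ.toList.map (loopElt x₀ γ)).map (· ^ n))) :
    ∃ α : H2 ℚ γ, H2.boundary ℚ γ α = circlesClass ℚ ι ∧
      gromovNorm γ α ≤ (4 * k + (7 * Fintype.card ι + 2)) / n := by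
  obtain ⟨a, ha, han⟩ := exists_relCycle γ h
  have hn' : (n : ℚ) ≠ 0 := by exact_mod_cast hn
  choose f hf using fun i : ι => exists_multiLoop_eq ℚ i n
  set e : SChain ℚ 1 (Circles ι) := circlesCycle ℚ ι +
    bd ℚ (Circles ι) 1 ((n : ℚ)⁻¹ • ∑ i, f i) with he
  have hbd : bd ℚ (Cyl γ) 1 ((n : ℚ)⁻¹ • a) = push ℚ 1 (cylTop γ) e := by
    rw [map_smul, ha, ← map_smul]
    congr 1
    simp only [he, hf, Finset.sum_add_distrib, smul_add, map_smul, map_sum, circlesCycle]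
    rw [← Finset.smul_sum, inv_smul_smul₀ hn']
  let A : relCycles ℚ 1 (cylTop γ) := ⟨(n : ℚ)⁻¹ • a, e, hbd.symm⟩
  have hA : bdInSub ℚ 1 (cylTop_injective γ) A = e :=
    push_injective ℚ (cylTop_injective γ) ((push_bdInSub ℚ 1 (cylTop_injective γ) A).trans hbd)
  refine ⟨relClass ℚ 1 (cylTop γ) A, (boundary_relClass_eq_iff A).2 ⟨_, hA⟩,
    (gromovNorm_relClass_le A).trans ?_⟩
  have h1 : norm1 ((n : ℚ)⁻¹ • a) ≤ (4 * k + (7 * Fintype.card ι + 2)) / n := by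
    rw [norm1_smul, abs_of_nonneg (by positivity), div_eq_inv_mul]
    gcongr
  have h2 : ((norm1 ((n : ℚ)⁻¹ • a) : ℚ) : ℝ) ≤
      ((4 * k + (7 * Fintype.card ι + 2) : ℕ) : ℝ) / (n : ℝ) := by
    have : ((norm1 ((n : ℚ)⁻¹ • a) : ℚ) : ℝ) ≤
      (((4 * k + (7 * Fintype.card ι + 2)) / n : ℚ) : ℝ) := by exact_mod_cast h1
    push_cast at this ⊢
    exact this
  refine (ENNReal.ofReal_le_ofReal h2).trans_eq ?_
  rw [ENNReal.ofReal_div_of_pos (by positivity), ENNReal.ofReal_natCast, ENNReal.ofReal_natCast]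
  push_cast
  rfl

variable (x₀) in
lemma iInf_gromovNorm_le_sclSum :
    1 / 4 * (⨅ (α : H2 ℚ γ) (_ : H2.boundary ℚ γ α = circlesClass ℚ ι), gromovNorm γ α) ≤
      sclSum (Finset.univ.toList.map (loopElt x₀ γ)) := by
  set B := ⨅ (α : H2 ℚ γ) (_ : H2.boundary ℚ γ α = circlesClass ℚ ι), gromovNorm γ α with hB
  have h0 : Filter.liminf (fun _ : ℕ => 1 / 4 * B) Filter.atTop = 1 / 4 * B :=
    Filter.liminf_const _
  rw [← h0, sclSum]
  refine liminf_le_liminf_of_le_add_div (C := ((7 * Fintype.card ι + 2 : ℕ) : ℝ≥0∞)) (ENNReal.natCast_ne_top _)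
    fun n hn => ?_
  rw [← ENNReal.add_div]
  induction hk : commLengthSum ((Finset.univ.toList.map (loopElt x₀ γ)).map (· ^ n)) with
  | top => simp [ENNReal.top_div]
  | coe k =>
    obtain ⟨α, hα, hle⟩ := exists_gromovNorm_le γ hn (commLengthSum_le_iff.1 hk.le)
    have h1 : B ≤ (4 * k + (7 * Fintype.card ι + 2)) / n := (iInf₂_le α hα).trans hle
    -- The constant is enlarged by a factor 4 so that 1/4 cancels exactly; it vanishes in the limit
    -- anyway.
    calc 1 / 4 * B ≤ 1 / 4 * ((4 * k + 4 * (7 * Fintype.card ι + 2)) / n) := by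
          refine mul_le_mul_right (h1.trans ?_) _
          gcongr
          exact le_mul_of_one_le_left (by simp) (by norm_num)
      _ = _ := by
          rw [← mul_add, mul_div_assoc, ← mul_assoc, ENNReal.div_mul_cancel (by simp) (by simp),
            one_mul]
          push_cast
          simp

end Fillings

/-! ### Comparison -/

section Comparison

lemma comparable_of_forall₂_isConj {G : Type*} [Group G] {L M : List G}
    (h : List.Forall₂ IsConj L M) : Comparable L M := by
  induction h with
  | nil => exact Comparable.of_perm (List.Perm.refl _)
  | @cons x y L M hxy _ ih =>
    have h1 : Comparable [x] [y] := by simpa using Comparable.conj_pow hxy 1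
    exact (h1.append_right L).trans (ih.append_left [y])

variable {X : Type*} [TopologicalSpace X] [PathConnectedSpace X] {x₀ : X} {ι : Type*} [Fintype ι]

lemma scl_eq_sclSum_loopElt {γ : C(Circles ι, X)} {c : FundamentalGroup X x₀ →₀ ℤ}
    (hγ : Represents γ (conjClass c)) :
    scl c = sclSum (Finset.univ.toList.map (loopElt x₀ γ)) := by
  obtain ⟨w, l, -, -, hc, hw⟩ := hγ
  rw [scl_eq_of_conjClass_eq w l c hc]
  refine (comparable_of_forall₂_isConj ?_).sclSum_eq
  rw [List.forall₂_map_left_iff, List.forall₂_map_right_iff, List.forall₂_same]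
  exact fun i _ => isConj_loopElt (hw i)

end Comparison

end GromovScl

end

theorem propositionA {X : Type*} [TopologicalSpace X] [PathConnectedSpace X] (x₀ : X)
    {ι : Type*} [Fintype ι] (γ : C(GromovScl.Circles ι, X))
    (c : FundamentalGroup X x₀ →₀ ℤ) (hγ : GromovScl.Represents γ (GromovScl.conjClass c)) :
    GromovScl.scl c =
      (1 / 4) * ⨅ (α : GromovScl.H2 ℚ γ)
        (_ : GromovScl.H2.boundary ℚ γ α = GromovScl.circlesClass ℚ ι),
        GromovScl.gromovNorm γ α := by
  rw [GromovScl.scl_eq_sclSum_loopElt hγ]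
  refine le_antisymm ?_ (GromovScl.iInf_gromovNorm_le_sclSum x₀ γ)
  rw [ENNReal.mul_iInf_of_ne (by simp) (by simp)]
  refine le_iInf fun α => ?_
  rw [ENNReal.mul_iInf_of_ne (by simp) (by simp)]
  exact le_iInf fun hα => GromovScl.sclSum_loopElt_le_gromovNorm x₀ hα
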